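/- Let $B$ be a standard Brownian motion, $W_0=B$, $W_n(t)=\int_0^t W_{n-1}(s)\,ds$ for $n\ge 1$, $t\ge 0$, and let $$X_n(t)=e^{-(n+\frac12)t}\,W_n(e^t),\qquad n\ge 0,\ t\in\mathbb R .$$ Put $$H_n(v)=\prod_{k=0}^{n}\frac1{k+\frac12+iv},\qquad \hat X_n(t)=X_n(t)-E\bigl(X_n(t)\,\big|\,X_0(t),\dots,X_{n-1}(t)\bigr)$$ (for $n=0$ the conditioning is trivial). By a spectral noise we mean a centred, jointly Gaussian, additive complex random set function $\zeta$ on the Borel sets of finite Lebesgue measure with $E\,\zeta(A)\overline{\zeta(B)}=2\pi\,|A\cap B|$ and $\zeta(-A)=\overline{\zeta(A)}$ almost surely; integrals $\int F\,d\zeta$, $F\in L^2(\mathbb R;\mathbb C)$, are mean-square limits of integrals of step functions. There is a spectral noise $\zeta$ such that, for all $n\ge 0$ and $t\in\mathbb R$, almost surely $$X_n(t)=\frac1{2\pi}\int_{-\infty}^{\infty}H_n(v)e^{ivt}\,\zeta(dv),\tag{1}$$ and for every spectral noise $\zeta$ satisfying (1) for all $n$ and $t$, the process $\hat X_n$ has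 the spectral representation $$\hat X_n(t)=\frac1{2\pi}\int_{-\infty}^{\infty}\hat H_n(v)e^{ivt}\,\zeta(dv)\quad\text{almost surely, for all } n\ge 0,\ t\in\mathbb R,$$ where $$\hat H_n(v)=\frac{n!}{(2n)!}\,\frac{1}{n+\frac12+iv}\prod_{k=0}^{n-1}\frac{k+\frac12-iv}{k+\frac12+iv},$$ and, for $n\ge1$, $\hat H_n(v)=\dfrac{n!}{(2n)!}\,\dfrac{H_n(v)}{\overline{H_{n-1}(v)}}$. -/

import Mathlib

open MeasureTheory ProbabilityTheory Complex
open scoped NNReal ENNReal ComplexConjugate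

noncomputable section

namespace IntegratedBrownian

variable {Ω : Type*} [MeasurableSpace Ω]

/-- The `n`-fold integrated process: `W₀ = B` and `Wₙ₊₁(t) = ∫₀ᵗ Wₙ(s) ds`, for `t ≥ 0`
(only times `t ≥ 0` are ever used). -/
def W (B : ℝ≥0 → Ω → ℝ) : ℕ → ℝ → Ω → ℝ
  | 0, t, ω => B t.toNNReal ω
  | n + 1, t, ω => ∫ s in (0 : ℝ)..t, W B n s ω

/-- The stationary process `Xₙ(t) = e^{-(n + 1/2) t} Wₙ(eᵗ)`, `t ∈ ℝ`. -/
def X (B : ℝ≥0 → Ω → ℝ) (n : ℕ) (t : ℝ) (ω : Ω) : ℝ :=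
  Real.exp (-((n : ℝ) + 1 / 2) * t) * W B n (Real.exp t) ω

/-- The σ-algebra generated by the random variables `X₀(t), …, Xₙ₋₁(t)`
(the trivial one for `n = 0`). -/
abbrev lowerSigma (B : ℝ≥0 → Ω → ℝ) (n : ℕ) (t : ℝ) : MeasurableSpace Ω :=
  ⨆ k : Fin n, MeasurableSpace.comap (X B k t) inferInstance

/-- The innovation `X̂ₙ(t) = Xₙ(t) - E(Xₙ(t) | X₀(t), …, Xₙ₋₁(t))`. -/
def innovation (P : Measure Ω) (B : ℝ≥0 → Ω → ℝ) (n : ℕ) (t : ℝ) (ω : Ω) : ℝ :=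
  X B n t ω - (P[X B n t | lowerSigma B n t]) ω

/-- The transfer function `Hₙ(v) = ∏_{k=0}^{n} 1 / (k + 1/2 + iv)`. -/
def H (n : ℕ) (v : ℝ) : ℂ :=
  ∏ k ∈ Finset.range (n + 1), 1 / ((k : ℂ) + 1 / 2 + I * v)

/-- The function `Ĥₙ(v) = (n! / (2n)!) (n + 1/2 + iv)⁻¹ ∏_{k<n} (k + 1/2 - iv) / (k + 1/2 + iv)`. -/
def Hhat (n : ℕ) (v : ℝ) : ℂ :=
  ((n.factorial : ℂ) / ((2 * n).factorial : ℂ)) * (1 / ((n : ℂ) + 1 / 2 + I * v)) *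
    ∏ k ∈ Finset.range n, ((k : ℂ) + 1 / 2 - I * v) / ((k : ℂ) + 1 / 2 + I * v)

/-- The Borel sets of finite Lebesgue measure: the sets to which a noise assigns a value. -/
abbrev FiniteBorel : Type := {A : Set ℝ // MeasurableSet A ∧ volume A < ∞}

/-- `ζ` is the spectral noise of a real Gaussian white noise: a complex-valued random set function
on the Borel sets of finite Lebesgue measure, centred, jointly Gaussian, additive,
with `E ζ(dv) conj ζ(dv') = 2π δ_{vv'} dv`, and with the symmetry `ζ(-dv) = conj ζ(dv)` which says
that the noise in the time domain is real. -/
structure IsSpectralNoise (P : Measure Ω) (ζ : FiniteBorel → Ω → ℂ) : Prop where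
  gaussian : IsGaussianProcess ζ P
  mean_zero : ∀ A, ∫ ω, ζ A ω ∂P = 0
  additive : ∀ A B C : FiniteBorel, Disjoint A.1 B.1 → C.1 = A.1 ∪ B.1 →
    ∀ᵐ ω ∂P, ζ C ω = ζ A ω + ζ B ω
  covariance : ∀ A B : FiniteBorel,
    ∫ ω, ζ A ω * conj (ζ B ω) ∂P = ((2 * Real.pi * volume.real (A.1 ∩ B.1) : ℝ) : ℂ)
  symmetric : ∀ A B : FiniteBorel, B.1 = (fun v => -v) ⁻¹' A.1 →
    ∀ᵐ ω ∂P, ζ B ω = conj (ζ A ω)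

/-- `J = ∫ F(v) ζ(dv)`, the stochastic integral in mean square: `F` is square integrable and `J` is
the limit in `L²(P)` of the integrals `∑ᵢ cᵢ ζ(Aᵢ)` of step functions `∑ᵢ cᵢ 1_{Aᵢ}` which tend to
`F` in `L²(dv)`. -/
def IsNoiseIntegral (P : Measure Ω) (ζ : FiniteBorel → Ω → ℂ) (F : ℝ → ℂ) (J : Ω → ℂ) : Prop :=
  MemLp F 2 volume ∧ MemLp J 2 P ∧
    ∀ ε : ℝ≥0∞, 0 < ε → ∃ (m : ℕ) (c : Fin m → ℂ) (A : Fin m → FiniteBorel),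
      eLpNorm (fun v => F v - ∑ i, (A i).1.indicator (fun _ => c i) v) 2 volume < ε ∧
      eLpNorm (fun ω => J ω - ∑ i, c i * ζ (A i) ω) 2 P < ε

/-- The process `Y` has the spectral representation
`Y(t) = (1/2π) ∫ G(v) e^{ivt} ζ(dv)` almost surely, for every `t`. -/
def HasSpectralRepr (P : Measure Ω) (ζ : FiniteBorel → Ω → ℂ) (G : ℝ → ℂ) (Y : ℝ → Ω → ℝ) : Prop :=
  ∀ t : ℝ, ∃ J : Ω → ℂ,
    IsNoiseIntegral P ζ (fun v => G v * Complex.exp (I * v * t)) J ∧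
    ∀ᵐ ω ∂P, (Y t ω : ℂ) = 1 / (2 * Real.pi) * J ω

end IntegratedBrownian

end

/-!
The proof rests on one linear isometry `U : L²(dv) → L²(P)` with
`U (Hₙ(v) exp (ivt)) = √(2π) Xₙ(t)` for all `n` and `t`; the spectral noise is
`ζ(A) = √(2π) U(1_A)`, so that `∫ F dζ = √(2π) U(F)`.

For `n = 0` the two families `H₀(v) exp (ivt)` and `√(2π) X₀(t)` have the same Gram matrix
`2π exp (-|t - s| / 2)` (Fourier inversion for `exp (-|x| / 2)`), and the first one spans a dense
subspace because `H₀` has no zeros and the Fourier transform is injective. This determines `U`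
(`exists_spectral_isometry`). Its range lies in the closed linear span of the Brownian motion,
hence consists of centred jointly Gaussian variables (`hasGaussianLaw_spectral_isometry`), and it is
compatible with complex conjugation since `X₀` is real (`spectral_isometry_conj_comp_neg`). The
passage from `n` to `n + 1` is integration in time, which `U` respects: Riemann sums of
`r ↦ r ^ (n + 1/2 + iv) Hₙ(v)` converge in `L²(dv)`, those of `Wₙ` converge almost surely
(`spectral_isometry_transferW`).

For the innovations, put `s = 1/2 + iv`, so that `Hₙ = 1 / (s (s + 1) ⋯ (s + n))`. Partial fractions
give `Ĥₙ = Hₙ + ∑_{j < n} aⱼ Hⱼ` with real `aⱼ` (`exists_Hhat_eq_H_add_sum`), while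
`Ĥₙ conj Hⱼ`, for `j < n`, is a combination of `H₁, …, Hₙ`, whose integrals vanish
(`integral_Hhat_mul_conj_H`). Hence `Xₙ(t) + ∑ aⱼ Xⱼ(t)` is uncorrelated with
`X₀(t), …, Xₙ₋₁(t)`; by joint Gaussianity it is independent of them and therefore equals the
innovation (`innovation_ae_eq`). Its spectral representation with respect to any admissible noise
follows by linearity of the stochastic integral.
-/

namespace IntegratedBrownian

/-! ### Algebra of the transfer functions -/

lemma add_I_mul_ne_zero {a : ℝ} (ha : 0 < a) (v : ℝ) : (a : ℂ) + I * v ≠ 0 := by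
  intro h
  have := congrArg Complex.re h
  simp at this
  linarith

lemma sub_I_mul_ne_zero {a : ℝ} (ha : 0 < a) (v : ℝ) : (a : ℂ) - I * v ≠ 0 := by
  intro h
  have := congrArg Complex.re h
  simp at this
  linarith

lemma natCast_add_half_add_ne_zero (k : ℕ) (v : ℝ) : (k : ℂ) + 1 / 2 + I * v ≠ 0 := by
  have := add_I_mul_ne_zero (a := k + 1 / 2) (by positivity) v
  push_cast at this
  exact this

lemma natCast_add_half_sub_ne_zero (k : ℕ) (v : ℝ) : (k : ℂ) + 1 / 2 - I * v ≠ 0 := by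
  have := sub_I_mul_ne_zero (a := k + 1 / 2) (by positivity) v
  push_cast at this
  exact this

lemma H_zero (v : ℝ) : H 0 v = 1 / (1 / 2 + I * v) := by
  simp [H]

lemma H_succ (n : ℕ) (v : ℝ) :
    H (n + 1) v = H n v * (1 / (((n + 1 : ℕ) : ℂ) + 1 / 2 + I * v)) := by
  rw [H, Finset.prod_range_succ, H]

lemma H_ne_zero (n : ℕ) (v : ℝ) : H n v ≠ 0 :=
  Finset.prod_ne_zero_iff.2 fun k _ => one_div_ne_zero (natCast_add_half_add_ne_zero k v)

lemma H_neg (n : ℕ) (v : ℝ) : H n (-v) = conj (H n v) := by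
  simp [H, map_prod, map_ofNat]

lemma conj_H (n : ℕ) (v : ℝ) :
    conj (H n v) = ∏ k ∈ Finset.range (n + 1), 1 / ((k : ℂ) + 1 / 2 - I * v) := by
  simp [H, map_prod, map_ofNat, sub_eq_add_neg]

lemma norm_H_succ_le (n : ℕ) (v : ℝ) : ‖H (n + 1) v‖ ≤ ‖H n v‖ := by
  rw [H_succ, norm_mul]
  refine mul_le_of_le_one_right (norm_nonneg _) ?_
  rw [norm_div, norm_one]
  refine div_le_one_of_le₀ ?_ (norm_nonneg _)
  refine le_trans ?_ (Complex.abs_re_le_norm _)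
  have : (((n + 1 : ℕ) : ℂ) + 1 / 2 + I * v).re = n + 1 + 1 / 2 := by simp
  rw [this, abs_of_nonneg (by positivity)]
  linarith [Nat.cast_nonneg (α := ℝ) n]

lemma norm_H_le (n : ℕ) (v : ℝ) : ‖H n v‖ ≤ ‖H 0 v‖ := by
  induction n with
  | zero => rfl
  | succ n ih => exact (norm_H_succ_le n v).trans ih

lemma norm_H_zero_sq (v : ℝ) : ‖H 0 v‖ ^ 2 = ((1 / 2) ^ 2 + v ^ 2)⁻¹ := by
  rw [H_zero, norm_div, norm_one, div_pow, one_pow, ← Complex.normSq_eq_norm_sq,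
    Complex.normSq_apply, one_div]
  congr 1
  simp
  ring

lemma continuous_H (n : ℕ) : Continuous (H n) := by
  refine continuous_finsetProd _ fun k _ => ?_
  exact continuous_const.div (by fun_prop) (natCast_add_half_add_ne_zero k)

lemma Hhat_eq_mul_H (n : ℕ) (v : ℝ) :
    Hhat n v = ((n.factorial : ℂ) / ((2 * n).factorial : ℂ)) *
      ((∏ k ∈ Finset.range n, ((k : ℂ) + 1 / 2 - I * v)) * H n v) := by
  rw [Hhat, H, Finset.prod_range_succ]
  simp only [div_eq_mul_inv, Finset.prod_mul_distrib, one_mul]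
  ring

/-- A product of at most `n` factors that are affine in `s = 1/2 + iv`, times
`Hₙ = 1 / (s (s + 1) ⋯ (s + n))`, is a real linear combination of `Hₙ₋ᵣ, …, Hₙ`: each
factor is split as `c - s = (c + m) - (s + m)`, and `s + m` cancels the last factor of `Hₘ`. -/
lemma exists_prod_sub_mul_H_eq_sum (c : ℕ → ℝ) (n r : ℕ) (hr : r ≤ n) :
    ∃ a : ℕ → ℝ, (∀ m, m < n - r → a m = 0) ∧ (∀ m, n < m → a m = 0) ∧
      a n = ∏ k ∈ Finset.range r, (c k + n) ∧
      ∀ v : ℝ, (∏ k ∈ Finset.range r, ((c k : ℂ) - (1 / 2 + I * v))) * H n v =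
        ∑ m ∈ Finset.range (n + 1), (a m : ℂ) * H m v := by
  induction r with
  | zero =>
    refine ⟨fun m => if m = n then 1 else 0, fun m hm => by simp; omega,
      fun m hm => by simp; omega, by simp, fun v => ?_⟩
    rw [Finset.sum_range_succ, Finset.sum_eq_zero fun m hm => ?_]
    · simp
    · simp [(Finset.mem_range.1 hm).ne]
  | succ r ih =>
    obtain ⟨a, ha0, ha1, han, ha⟩ := ih (by omega)
    refine ⟨fun m => (c r + m) * a m - a (m + 1), fun m hm => ?_, fun m hm => ?_, ?_, fun v => ?_⟩
    · simp [ha0 m (by omega), ha0 (m + 1) (by omega)]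
    · simp [ha1 m (by omega), ha1 (m + 1) (by omega)]
    · simp only [ha1 (n + 1) (by omega), Finset.prod_range_succ, han]
      ring
    · rw [Finset.prod_range_succ, mul_right_comm, ha v]
      have hstep : ∀ m : ℕ, H (m + 1) v * ((c r : ℂ) - (1 / 2 + I * v)) =
          (c r + (m + 1 : ℕ)) * H (m + 1) v - H m v := fun m => by
        have h := natCast_add_half_add_ne_zero (m + 1) v
        have hc : H m v * (1 / (((m + 1 : ℕ) : ℂ) + 1 / 2 + I * v)) *
            (((m + 1 : ℕ) : ℂ) + 1 / 2 + I * v) = H m v := by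
          rw [mul_assoc, one_div_mul_cancel h, mul_one]
        rw [H_succ]
        linear_combination -hc
      have hshift : ∑ m ∈ Finset.range (n + 1), (a (m + 1) : ℂ) * H m v =
          ∑ m ∈ Finset.range n, (a (m + 1) : ℂ) * H m v := by
        rw [Finset.sum_range_succ, ha1 (n + 1) (by omega)]
        simp
      push_cast
      simp only [sub_mul, Finset.sum_sub_distrib]
      rw [hshift, Finset.sum_mul, Finset.sum_range_succ', Finset.sum_range_succ' (n := n)]
      have h0 : a 0 = 0 := ha0 0 (by omega)
      simp only [h0, ofReal_zero, mul_zero, zero_mul, add_zero]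
      rw [← Finset.sum_sub_distrib]
      refine Finset.sum_congr rfl fun m _ => ?_
      rw [mul_assoc, hstep m]
      push_cast
      ring

/-- The normalisation `n! / (2n)!` makes `Hₙ` appear in `Ĥₙ` with coefficient one. -/
lemma exists_Hhat_eq_H_add_sum (n : ℕ) :
    ∃ a : ℕ → ℝ, ∀ v : ℝ, Hhat n v = H n v + ∑ j ∈ Finset.range n, (a j : ℂ) * H j v := by
  obtain ⟨a, -, -, han, ha⟩ := exists_prod_sub_mul_H_eq_sum (fun k => k + 1) n n le_rfl
  have hfac : ((n.factorial : ℝ) / ((2 * n).factorial : ℝ)) * a n = 1 := by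
    have h1 : a n = ((n + 1).ascFactorial n : ℝ) := by
      rw [han, Nat.ascFactorial_eq_prod_range]
      push_cast
      exact Finset.prod_congr rfl fun k _ => by ring
    have h2 := Nat.factorial_mul_ascFactorial n n
    rw [← two_mul] at h2
    rw [h1, div_mul_eq_mul_div, ← Nat.cast_mul, h2]
    exact div_self (by positivity)
  refine ⟨fun j => ((n.factorial : ℝ) / ((2 * n).factorial : ℝ)) * a j, fun v => ?_⟩
  have hprod : ∏ k ∈ Finset.range n, ((k : ℂ) + 1 / 2 - I * v) =
      ∏ k ∈ Finset.range n, ((((k : ℝ) + 1 : ℝ) : ℂ) - (1 / 2 + I * v)) :=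
    Finset.prod_congr rfl fun k _ => by push_cast; ring
  rw [Hhat_eq_mul_H, hprod, ha v, Finset.sum_range_succ, mul_add, add_comm, ← mul_assoc,
    Finset.mul_sum]
  congr 1
  · have := congrArg (fun x : ℝ => (x : ℂ)) hfac
    push_cast at this
    rw [this, one_mul]
  · refine Finset.sum_congr rfl fun j _ => ?_
    push_cast
    ring

lemma Hhat_eq_H_div_conj_H (n : ℕ) (v : ℝ) (hn : 1 ≤ n) :
    Hhat n v = ((n.factorial : ℂ) / ((2 * n).factorial : ℂ)) * (H n v / conj (H (n - 1) v)) := by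
  rw [Hhat_eq_mul_H, conj_H, Nat.sub_add_cancel hn]
  simp only [one_div, Finset.prod_inv_distrib, div_inv_eq_mul]
  ring

/-! ### Orthogonality in the frequency domain -/

lemma integrable_inv_sq_add_sq {a : ℝ} (ha : 0 < a) :
    Integrable fun v : ℝ => (a ^ 2 + v ^ 2)⁻¹ := by
  have h := (integrable_inv_one_add_sq.comp_div ha.ne').const_mul (a ^ 2)⁻¹
  refine h.congr (Filter.Eventually.of_forall fun v => ?_)
  simp only
  rw [← mul_inv]
  congr 1
  field_simp

lemma norm_add_I_mul_sq (a v : ℝ) : ‖(a : ℂ) + I * v‖ ^ 2 = a ^ 2 + v ^ 2 := by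
  rw [← Complex.normSq_eq_norm_sq, Complex.normSq_apply]
  simp
  ring

/-- The two-pole case: `log ((a + iv) / (a + 1 + iv))` is, up to the factor `i`, an antiderivative
that tends to `0` at both ends. -/
lemma integrable_and_integral_two_poles {a : ℝ} (ha : 0 < a) :
    Integrable (fun v : ℝ => 1 / ((a : ℂ) + I * v) * (1 / ((a : ℂ) + 1 + I * v))) ∧
      ∫ v : ℝ, 1 / ((a : ℂ) + I * v) * (1 / ((a : ℂ) + 1 + I * v)) = 0 := by
  have h1 : ∀ v : ℝ, (a : ℂ) + I * v ≠ 0 := add_I_mul_ne_zero ha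
  have h2 : ∀ v : ℝ, (a : ℂ) + 1 + I * v ≠ 0 := fun v => by
    simpa using add_I_mul_ne_zero (a := a + 1) (by linarith) v
  have hint : Integrable
      (fun v : ℝ => 1 / ((a : ℂ) + I * v) * (1 / ((a : ℂ) + 1 + I * v))) := by
    refine (integrable_inv_sq_add_sq ha).mono' ?_ (Filter.Eventually.of_forall fun v => ?_)
    · exact ((continuous_const.div (by fun_prop) h1).mul
        (continuous_const.div (by fun_prop) h2)).aestronglyMeasurable
    · rw [norm_mul, norm_div, norm_div, norm_one, one_div_mul_one_div, one_div,
        ← norm_add_I_mul_sq, sq]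
      have h3 : ‖(a : ℂ) + I * v‖ ≤ ‖(a : ℂ) + 1 + I * v‖ := by
        refine abs_le_of_sq_le_sq' ?_ (norm_nonneg _) |>.2
        have := norm_add_I_mul_sq (a + 1) v
        push_cast at this
        rw [norm_add_I_mul_sq, this]
        nlinarith
      have h4 : 0 < ‖(a : ℂ) + I * v‖ := norm_pos_iff.2 (h1 v)
      gcongr
  refine ⟨hint, ?_⟩
  set q : ℝ → ℂ := fun v => ((a : ℂ) + I * v) / ((a : ℂ) + 1 + I * v) with hq
  have hq1 : ∀ v, q v = 1 - 1 / ((a : ℂ) + 1 + I * v) := fun v => by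
    have := h2 v
    simp only [hq]
    field_simp
    ring
  have hre : ∀ v, 0 < (q v).re := fun v => by
    simp only [hq, Complex.div_re]
    have : 0 < Complex.normSq ((a : ℂ) + 1 + I * v) := Complex.normSq_pos.2 (h2 v)
    simp
    rw [← add_div]
    have : 0 < a * (a + 1) + v * v := by nlinarith [mul_self_nonneg v]
    positivity
  have hderiv : ∀ v : ℝ, HasDerivAt (fun v : ℝ => -I * Complex.log (q v))
      (1 / ((a : ℂ) + I * v) * (1 / ((a : ℂ) + 1 + I * v))) v := fun v => by
    have hI : HasDerivAt (fun v : ℝ => I * (v : ℂ)) I v := by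
      simpa using (Complex.ofRealCLM.hasDerivAt (x := v)).const_mul I
    have hd := (hI.const_add (a : ℂ)).div (hI.const_add ((a : ℂ) + 1)) (h2 v)
    have hl := (HasDerivAt.clog_real hd (Or.inl (hre v))).const_mul (-I)
    convert! hl using 1
    have e1 := h1 v
    have e2 := h2 v
    simp only [Pi.div_apply]
    field_simp
    ring_nf
    simp [Complex.I_sq]
  have hcob : Filter.Tendsto (fun v : ℝ => ‖(a : ℂ) + 1 + I * v‖) (Filter.cocompact ℝ)
      Filter.atTop := by
    refine Filter.tendsto_atTop_mono (fun v => ?_) tendsto_norm_cocompact_atTop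
    refine le_trans (le_of_eq ?_) (Complex.abs_im_le_norm _)
    simp
  have hlim : Filter.Tendsto (fun v : ℝ => -I * Complex.log (q v)) (Filter.cocompact ℝ)
      (nhds 0) := by
    have hq2 : Filter.Tendsto q (Filter.cocompact ℝ) (nhds 1) := by
      have : Filter.Tendsto (fun v : ℝ => 1 / ((a : ℂ) + 1 + I * v)) (Filter.cocompact ℝ)
          (nhds 0) := by
        rw [tendsto_zero_iff_norm_tendsto_zero]
        simp only [one_div, norm_inv]
        exact hcob.inv_tendsto_atTop
      have h3 := (tendsto_const_nhds (x := (1 : ℂ))).sub this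
      rw [sub_zero] at h3
      exact h3.congr fun v => (hq1 v).symm
    have := ((continuousAt_clog (x := 1) (by simp)).tendsto.comp hq2).const_mul (-I)
    simpa using this
  have h := integral_of_hasDerivAt_of_tendsto hderiv hint
    (hlim.mono_left atBot_le_cocompact) (hlim.mono_left atTop_le_cocompact)
  simpa using h

/-- All poles lie in one half-plane and the decay is at least quadratic, so the integral vanishes;
partial fractions reduce the claim to two poles. -/
lemma integrable_and_integral_prod_poles (m : ℕ) {a : ℝ} (ha : 0 < a) :
    Integrable (fun v : ℝ => ∏ k ∈ Finset.range (m + 2), 1 / ((a : ℂ) + k + I * v)) ∧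
      ∫ v : ℝ, ∏ k ∈ Finset.range (m + 2), 1 / ((a : ℂ) + k + I * v) = 0 := by
  induction m generalizing a with
  | zero => simpa [Finset.prod_range_succ, mul_comm] using integrable_and_integral_two_poles ha
  | succ m ih =>
    obtain ⟨i1, z1⟩ := ih ha
    obtain ⟨i2, z2⟩ := ih (a := a + 1) (by linarith)
    have hne : ∀ (k : ℕ) (v : ℝ), (a : ℂ) + k + I * v ≠ 0 := fun k v => by
      simpa using add_I_mul_ne_zero (a := a + k) (by positivity) v
    have key : ∀ v : ℝ, ∏ k ∈ Finset.range (m + 1 + 2), 1 / ((a : ℂ) + k + I * v) =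
        ((m : ℂ) + 2)⁻¹ * (∏ k ∈ Finset.range (m + 2), 1 / ((a : ℂ) + k + I * v) -
          ∏ k ∈ Finset.range (m + 2), 1 / (((a + 1 : ℝ) : ℂ) + k + I * v)) := fun v => by
      have e : ∏ k ∈ Finset.range (m + 2), 1 / (((a + 1 : ℝ) : ℂ) + k + I * v) =
          (∏ k ∈ Finset.range (m + 1), 1 / ((a : ℂ) + (k + 1 : ℕ) + I * v)) *
            (1 / ((a : ℂ) + (m + 2 : ℕ) + I * v)) := by
        rw [Finset.prod_range_succ]
        congr 1
        · exact Finset.prod_congr rfl fun k _ => by push_cast; ring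
        · push_cast; ring
      rw [e, show m + 1 + 2 = (m + 1 + 1) + 1 by ring, Finset.prod_range_succ,
        Finset.prod_range_succ']
      have e1 := hne 0 v
      have e2 := hne (m + 2) v
      have e3 : (m : ℂ) + 2 ≠ 0 := by exact_mod_cast (Nat.succ_ne_zero (m + 1))
      push_cast at *
      rw [show m + 1 + 1 = (m + 2) from rfl] at *
      field_simp
      ring
    simp_rw [key]
    refine ⟨(i1.sub i2).const_mul _, ?_⟩
    rw [integral_const_mul, integral_sub i1 i2, z1, z2, sub_zero, mul_zero]

lemma integrable_H_succ (m : ℕ) : Integrable (H (m + 1)) := by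
  have := (integrable_and_integral_prod_poles m (a := 1 / 2) (by norm_num)).1
  refine this.congr (Filter.Eventually.of_forall fun v => ?_)
  exact Finset.prod_congr rfl fun k _ => by push_cast; ring

lemma integral_H_succ (m : ℕ) : ∫ v, H (m + 1) v = 0 := by
  rw [← (integrable_and_integral_prod_poles m (a := 1 / 2) (by norm_num)).2]
  refine integral_congr_ae (Filter.Eventually.of_forall fun v => ?_)
  exact Finset.prod_congr rfl fun k _ => by push_cast; ring

lemma integral_Hhat_mul_conj_H {n j : ℕ} (hj : j < n) :
    ∫ v, Hhat n v * conj (H j v) = 0 := by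
  obtain ⟨a, ha0, -, -, ha⟩ :=
    exists_prod_sub_mul_H_eq_sum (fun k => j + k + 2) n (n - 1 - j) (by omega)
  have key : ∀ v, Hhat n v * conj (H j v) =
      ((n.factorial : ℂ) / ((2 * n).factorial : ℂ)) *
        ∑ m ∈ Finset.range n, (a (m + 1) : ℂ) * H (m + 1) v := fun v => by
    have hsum := ha v
    rw [Finset.sum_range_succ', ha0 0 (by omega)] at hsum
    simp only [ofReal_zero, zero_mul, add_zero] at hsum
    rw [← hsum, Hhat_eq_mul_H, conj_H, mul_assoc]
    congr 1
    have hsplit := Finset.prod_range_add (fun k : ℕ => (k : ℂ) + 1 / 2 - I * v) (j + 1) (n - 1 - j)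
    rw [show j + 1 + (n - 1 - j) = n by omega] at hsplit
    have hcancel : (∏ k ∈ Finset.range (j + 1), ((k : ℂ) + 1 / 2 - I * v)) *
        ∏ k ∈ Finset.range (j + 1), 1 / ((k : ℂ) + 1 / 2 - I * v) = 1 := by
      rw [← Finset.prod_mul_distrib]
      exact Finset.prod_eq_one fun k _ => mul_one_div_cancel (natCast_add_half_sub_ne_zero k v)
    have htail : ∏ k ∈ Finset.range (n - 1 - j), (((j + 1 + k : ℕ) : ℂ) + 1 / 2 - I * v) =
        ∏ k ∈ Finset.range (n - 1 - j), ((((j : ℝ) + k + 2 : ℝ) : ℂ) - (1 / 2 + I * v)) :=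
      Finset.prod_congr rfl fun k _ => by push_cast; ring
    rw [hsplit, htail]
    linear_combination (∏ k ∈ Finset.range (n - 1 - j),
      ((((j : ℝ) + k + 2 : ℝ) : ℂ) - (1 / 2 + I * v))) * H n v * hcancel
  simp_rw [key]
  rw [integral_const_mul, integral_finsetSum _ fun m _ => (integrable_H_succ m).const_mul _]
  simp [integral_const_mul, integral_H_succ]

lemma memLp_H (n : ℕ) : MemLp (H n) 2 := by
  have h0 : MemLp (H 0) 2 := by
    rw [memLp_two_iff_integrable_sq_norm (continuous_H 0).aestronglyMeasurable]
    simp_rw [norm_H_zero_sq]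
    exact integrable_inv_sq_add_sq (by norm_num)
  exact h0.mono (continuous_H n).aestronglyMeasurable
    (Filter.Eventually.of_forall (norm_H_le n))

end IntegratedBrownian

namespace IntegratedBrownian

/-! ### Fourier analysis -/

/-- The Fourier transform of `x ↦ exp (-|x| / 2)`. -/
lemma integrable_and_fourier_exp_neg_abs :
    Integrable (fun x : ℝ => cexp (-(|x| / 2 : ℝ))) ∧
      ∀ w : ℝ, FourierTransform.fourier (fun x : ℝ => cexp (-(|x| / 2 : ℝ))) w =
        ((((1 / 2) ^ 2 + (2 * Real.pi * w) ^ 2)⁻¹ : ℝ) : ℂ) := by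
  have hIoi : ∀ w : ℝ, Set.EqOn (fun x : ℝ => cexp ((-2 * Real.pi * x * w : ℝ) * I) •
      cexp (-(|x| / 2 : ℝ))) (fun x : ℝ => cexp ((-(1 / 2) - 2 * Real.pi * w * I) * x))
      (Set.Ioi 0) := fun w x hx => by
    have hx' : (0 : ℝ) < x := hx
    simp only [smul_eq_mul, ← Complex.exp_add, abs_of_pos hx']
    congr 1
    push_cast
    ring
  have hIic : ∀ w : ℝ, Set.EqOn (fun x : ℝ => cexp ((-2 * Real.pi * x * w : ℝ) * I) •
      cexp (-(|x| / 2 : ℝ))) (fun x : ℝ => cexp ((1 / 2 - 2 * Real.pi * w * I) * x))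
      (Set.Iic 0) := fun w x hx => by
    have hx' : x ≤ 0 := hx
    simp only [smul_eq_mul, ← Complex.exp_add, abs_of_nonpos hx']
    congr 1
    push_cast
    ring
  have hre1 : ∀ w : ℝ, (-(1 / 2) - 2 * Real.pi * w * I : ℂ).re < 0 := fun w => by simp
  have hre2 : ∀ w : ℝ, 0 < (1 / 2 - 2 * Real.pi * w * I : ℂ).re := fun w => by simp
  have iIoi : ∀ w : ℝ, IntegrableOn (fun x : ℝ => cexp ((-2 * Real.pi * x * w : ℝ) * I) •
      cexp (-(|x| / 2 : ℝ))) (Set.Ioi 0) := fun w =>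
    (integrableOn_congr_fun (hIoi w) measurableSet_Ioi).2
      (integrableOn_exp_mul_complex_Ioi (hre1 w) 0)
  have iIic : ∀ w : ℝ, IntegrableOn (fun x : ℝ => cexp ((-2 * Real.pi * x * w : ℝ) * I) •
      cexp (-(|x| / 2 : ℝ))) (Set.Iic 0) := fun w =>
    (integrableOn_congr_fun (hIic w) measurableSet_Iic).2
      (integrableOn_exp_mul_complex_Iic (hre2 w) 0)
  refine ⟨?_, fun w => ?_⟩
  · have h := (iIic 0).union (iIoi 0)
    rw [Set.Iic_union_Ioi, integrableOn_univ] at h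
    simpa using h
  · rw [Real.fourier_real_eq_integral_exp_smul,
      ← intervalIntegral.integral_Iic_add_Ioi (iIic w) (iIoi w),
      setIntegral_congr_fun measurableSet_Iic (hIic w),
      setIntegral_congr_fun measurableSet_Ioi (hIoi w),
      integral_exp_mul_complex_Iic (hre2 w), integral_exp_mul_complex_Ioi (hre1 w)]
    have n1 : (1 / 2 - 2 * Real.pi * w * I : ℂ) ≠ 0 := fun h => by
      have := hre2 w
      rw [h] at this
      simp at this
    have n2 : (-(1 / 2) - 2 * Real.pi * w * I : ℂ) ≠ 0 := fun h => by
      have := hre1 w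
      rw [h] at this
      simp at this
    have n3 : ((1 / 2 : ℂ) ^ 2 + (2 * Real.pi * w) ^ 2) ≠ 0 := by
      have : (0 : ℝ) < (1 / 2) ^ 2 + (2 * Real.pi * w) ^ 2 := by positivity
      have h := Complex.ofReal_ne_zero.2 this.ne'
      push_cast at h
      exact h
    have hprod : (1 / 2 - 2 * Real.pi * w * I : ℂ) * (-(1 / 2) - 2 * Real.pi * w * I) =
        -((1 / 2 : ℂ) ^ 2 + (2 * Real.pi * w) ^ 2) := by
      linear_combination (2 * Real.pi * w : ℂ) ^ 2 * Complex.I_sq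
    simp only [ofReal_zero, mul_zero, Complex.exp_zero]
    rw [div_add_div _ _ n1 n2, hprod]
    push_cast
    field_simp
    ring

/-- The spectral form of the covariance of the stationary Ornstein--Uhlenbeck process. -/
lemma integral_exp_mul_inv_sq_add_sq (t : ℝ) :
    ∫ v : ℝ, cexp (I * v * t) * ((((1 / 2) ^ 2 + v ^ 2)⁻¹ : ℝ) : ℂ) =
      2 * Real.pi * cexp (-(|t| / 2 : ℝ)) := by
  obtain ⟨hf, hF⟩ := integrable_and_fourier_exp_neg_abs
  have hpi : (2 * Real.pi : ℝ) ≠ 0 := by positivity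
  have hF' : Integrable (FourierTransform.fourier (fun x : ℝ => cexp (-(|x| / 2 : ℝ)))) := by
    rw [funext hF]
    have h := (integrable_inv_sq_add_sq (a := 1 / 2) (by norm_num)).comp_mul_left' hpi
    exact h.ofReal
  have hinv := hf.fourierInv_fourier_eq hF' (v := t)
    (by fun_prop)
  rw [Real.fourierInv_eq', funext hF] at hinv
  have hsub := Measure.integral_comp_mul_left
    (fun v : ℝ => cexp (I * v * t) * ((((1 / 2) ^ 2 + v ^ 2)⁻¹ : ℝ) : ℂ)) (2 * Real.pi)
  have hcongr : ∫ v : ℝ, cexp ((2 * Real.pi * inner ℝ v t : ℝ) * I) •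
      ((((1 / 2) ^ 2 + (2 * Real.pi * v) ^ 2)⁻¹ : ℝ) : ℂ) =
      ∫ v : ℝ, cexp (I * (2 * Real.pi * v : ℝ) * t) *
        ((((1 / 2) ^ 2 + (2 * Real.pi * v) ^ 2)⁻¹ : ℝ) : ℂ) := by
    refine integral_congr_ae (Filter.Eventually.of_forall fun v => ?_)
    simp only [smul_eq_mul]
    congr 2
    simp
    ring
  rw [hcongr, hsub, abs_of_pos (by positivity), Complex.real_smul] at hinv
  rw [← hinv, ← mul_assoc]
  have : (2 * (Real.pi : ℂ)) ≠ 0 := by exact_mod_cast hpi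
  push_cast
  rw [mul_inv_cancel₀ this, one_mul]

/-- An integrable function on the line whose Fourier transform vanishes is zero. -/
lemma ae_eq_zero_of_fourier_eq_zero {g : ℝ → ℂ} (hg : Integrable g)
    (h : ∀ w, FourierTransform.fourier g w = 0) : ∀ᵐ v, g v = 0 := by
  refine ae_eq_zero_of_integral_contDiff_smul_eq_zero hg.locallyIntegrable fun φ hφ hc => ?_
  have hc' : HasCompactSupport (fun x => (φ x : ℂ)) := hc.comp_left (g := ofReal) ofReal_zero
  have hφ' : ContDiff ℝ (⊤ : ℕ∞) (fun x => (φ x : ℂ)) := ofRealCLM.contDiff.comp hφ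
  set ψ : SchwartzMap ℝ ℂ := hc'.toSchwartzMap hφ' with hψ
  have hflip := VectorFourier.integral_fourierIntegral_smul_eq_flip (L := innerₗ ℝ)
    Real.continuous_fourierChar continuous_inner
    (FourierTransformInv.fourierInv ψ).integrable (μ := volume) (ν := volume) hg
  have h1 : ∫ v, FourierTransform.fourier (FourierTransformInv.fourierInv ψ) v • g v =
      ∫ x, (FourierTransformInv.fourierInv ψ) x • FourierTransform.fourier g x := by
    rw [SchwartzMap.fourier_coe]
    rw [flip_innerₗ] at hflip
    exact hflip
  rw [FourierTransform.fourier_fourierInv_eq] at h1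
  simp only [h, smul_zero, integral_zero] at h1
  rw [← h1]
  refine integral_congr_ae (Filter.Eventually.of_forall fun v => ?_)
  simp [hψ]

lemma norm_exp_I_mul (v t : ℝ) : ‖cexp (I * v * t)‖ = 1 := by
  rw [show I * v * t = ((v * t : ℝ) : ℂ) * I by push_cast; ring]
  exact Complex.norm_exp_ofReal_mul_I _

lemma conj_exp_I_mul (v t : ℝ) : conj (cexp (I * v * t)) = cexp (-(I * v * t)) := by
  rw [← Complex.exp_conj]
  simp

lemma memLp_mul_exp {G : ℝ → ℂ} (hG : MemLp G 2) (t : ℝ) :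
    MemLp (fun v : ℝ => G v * cexp (I * v * t)) 2 := by
  refine hG.mono (hG.aestronglyMeasurable.mul (by fun_prop))
    (Filter.Eventually.of_forall fun v => ?_)
  rw [norm_mul, norm_exp_I_mul, mul_one]

/-- The element `v ↦ Hₙ(v) exp (ivt)` of `L²(dv)`. -/
noncomputable def spectralFun (n : ℕ) (t : ℝ) : Lp ℂ 2 (volume : Measure ℝ) :=
  (memLp_mul_exp (memLp_H n) t).toLp _

lemma coeFn_spectralFun (n : ℕ) (t : ℝ) :
    spectralFun n t =ᵐ[volume] fun v : ℝ => H n v * cexp (I * v * t) :=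
  MemLp.coeFn_toLp _

lemma inner_spectralFun (m n : ℕ) (s t : ℝ) :
    inner ℂ (spectralFun m s) (spectralFun n t) =
      ∫ v : ℝ, cexp (I * v * (t - s : ℝ)) * (H n v * conj (H m v)) := by
  rw [L2.inner_def]
  refine integral_congr_ae ?_
  filter_upwards [coeFn_spectralFun m s, coeFn_spectralFun n t] with v h1 h2
  rw [h1, h2, RCLike.inner_apply, map_mul, conj_exp_I_mul, show I * v * (t - s : ℝ) =
    I * v * t + -(I * v * s) by push_cast; ring, Complex.exp_add]
  ring

lemma inner_spectralFun_zero (s t : ℝ) :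
    inner ℂ (spectralFun 0 s) (spectralFun 0 t) =
      2 * Real.pi * cexp (-(|t - s| / 2 : ℝ)) := by
  rw [inner_spectralFun, ← integral_exp_mul_inv_sq_add_sq]
  refine integral_congr_ae (Filter.Eventually.of_forall fun v => ?_)
  simp only
  rw [Complex.mul_conj, Complex.normSq_eq_norm_sq, norm_H_zero_sq]

/-- The functions `v ↦ H₀(v) exp (ivt)` span a dense subspace, because `H₀` has no zeros and the
Fourier transform is injective. -/
lemma dense_span_spectralFun_zero :
    (Submodule.span ℂ (Set.range (spectralFun 0))).topologicalClosure = ⊤ := by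
  rw [Submodule.topologicalClosure_eq_top_iff, Submodule.eq_bot_iff]
  intro f hf
  have horth : ∀ t, inner ℂ (spectralFun 0 t) f = 0 := fun t =>
    (Submodule.mem_orthogonal _ _).1 hf _ (Submodule.subset_span ⟨t, rfl⟩)
  have hg : Integrable (fun v => conj (H 0 v) * f v) := by
    have h1 : MemLp (fun v => conj (H 0 v)) 2 := (memLp_H 0).star
    exact h1.integrable_mul (Lp.memLp f)
  have hF : ∀ w, FourierTransform.fourier (fun v => conj (H 0 v) * f v) w = 0 := fun w => by
    rw [Real.fourier_real_eq_integral_exp_smul, ← horth (2 * Real.pi * w), L2.inner_def]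
    refine integral_congr_ae ?_
    filter_upwards [coeFn_spectralFun 0 (2 * Real.pi * w)] with v hv
    rw [hv, RCLike.inner_apply, map_mul, conj_exp_I_mul, smul_eq_mul]
    have : ((-2 * Real.pi * v * w : ℝ) : ℂ) * I = -(I * v * (2 * Real.pi * w : ℝ)) := by
      push_cast; ring
    rw [this]
    ring
  rw [Lp.eq_zero_iff_ae_eq_zero]
  filter_upwards [ae_eq_zero_of_fourier_eq_zero hg hF] with v hv
  simpa [H_ne_zero] using hv

end IntegratedBrownian

namespace IntegratedBrownian

/-! ### Isometries determined by Gram matrices -/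

/-- Two families of vectors with the same Gram matrix, the first of which spans a dense subspace,
are related by a linear isometry. -/
lemma exists_linearIsometry_of_inner_eq {ι E F : Type*} [NormedAddCommGroup E]
    [InnerProductSpace ℂ E] [NormedAddCommGroup F] [InnerProductSpace ℂ F] [CompleteSpace F]
    (e : ι → E) (x : ι → F) (h : ∀ i j, inner ℂ (e i) (e j) = inner ℂ (x i) (x j))
    (hd : (Submodule.span ℂ (Set.range e)).topologicalClosure = ⊤) :
    ∃ U : E →ₗᵢ[ℂ] F, ∀ i, U (e i) = x i := by
  set T := Finsupp.linearCombination ℂ e with hT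
  set S := Finsupp.linearCombination ℂ x with hS
  have hdense : DenseRange T := by
    have := Submodule.dense_iff_topologicalClosure_eq_top.2 hd
    rw [← Finsupp.range_linearCombination] at this
    rwa [DenseRange, ← LinearMap.coe_range]
  have hnorm : ∀ a, ‖S a‖ = ‖T a‖ := fun a => by
    have : inner ℂ (S a) (S a) = inner ℂ (T a) (T a) := by
      simp only [hS, hT, Finsupp.linearCombination_apply, Finsupp.sum, sum_inner, inner_sum,
        inner_smul_left, inner_smul_right, h]
    rw [inner_self_eq_norm_sq_to_K, inner_self_eq_norm_sq_to_K] at this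
    have h2 : ‖S a‖ ^ 2 = ‖T a‖ ^ 2 := by exact_mod_cast this
    exact (sq_eq_sq₀ (norm_nonneg _) (norm_nonneg _)).1 h2
  have hext : ∀ a, S.extendOfNorm T (T a) = S a :=
    LinearMap.extendOfNorm_eq hdense ⟨1, fun a => by rw [hnorm, one_mul]⟩
  refine ⟨⟨(S.extendOfNorm T).toLinearMap, fun y => ?_⟩, fun i => ?_⟩
  · refine hdense.induction_on (p := fun y => ‖S.extendOfNorm T y‖ = ‖y‖) y
      (isClosed_eq (by fun_prop) (by fun_prop)) fun a => ?_
    rw [hext, hnorm]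
  · have := hext (Finsupp.single i 1)
    simpa [hS, hT] using this

/-! ### Gaussian random variables in `L²` -/

lemma norm_sq_eq_integral_sq {Ω : Type*} [MeasurableSpace Ω] {P : Measure Ω} (Y : Lp ℝ 2 P) :
    ‖Y‖ ^ 2 = ∫ ω, Y ω ^ 2 ∂P := by
  rw [← real_inner_self_eq_norm_sq, L2.inner_def]
  refine integral_congr_ae (Filter.Eventually.of_forall fun ω => ?_)
  simp [sq]

lemma integral_exp_eq_of_hasGaussianLaw {Ω : Type*} [MeasurableSpace Ω] {P : Measure Ω} {Y : Lp ℝ 2 P}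
    (hY : HasGaussianLaw Y P)
    (h0 : ∫ ω, Y ω ∂P = 0) : ∫ ω, cexp (I * Y ω) ∂P = cexp (-(‖Y‖ ^ 2 / 2 : ℝ)) := by
  have h := hY.charFun_map_eq 1
  rw [charFun_apply_real, integral_map hY.aemeasurable (by fun_prop)] at h
  simp only [RCLike.inner_apply, conj_trivial, mul_one, h0, ofReal_one, one_mul, ofReal_zero,
    zero_mul, zero_sub] at h
  rw [variance_of_integral_eq_zero hY.aemeasurable h0] at h
  simp_rw [mul_comm I]
  rw [h, norm_sq_eq_integral_sq]
  congr 1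
  push_cast
  rfl

section Gaussian

variable {Ω : Type*} [MeasurableSpace Ω] {P : Measure Ω} [IsProbabilityMeasure P]

lemma lipschitzWith_integral_exp_I_mul :
    LipschitzWith 1 fun Y : Lp ℝ 2 P => ∫ ω, cexp (I * Y ω) ∂P := by
  refine LipschitzWith.of_dist_le_mul fun Y Z => ?_
  have hi : ∀ Y : Lp ℝ 2 P, Integrable (fun ω => cexp (I * Y ω)) P := fun Y => by
    have hm : AEStronglyMeasurable (fun ω => cexp (I * Y ω)) P := by
      have := (Lp.aestronglyMeasurable Y).aemeasurable
      exact (by fun_prop : AEMeasurable (fun ω => cexp (I * Y ω)) P).aestronglyMeasurable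
    refine (integrable_const (1 : ℝ)).mono' hm (Filter.Eventually.of_forall fun ω => ?_)
    rw [mul_comm, Complex.norm_exp_ofReal_mul_I]
  have hD : Integrable (Y - Z : Lp ℝ 2 P) P := (Lp.memLp (Y - Z)).integrable one_le_two
  have hpt : ∀ y z : ℝ, ‖cexp (I * y) - cexp (I * z)‖ ≤ ‖y - z‖ := fun y z => by
    have : cexp (I * y) - cexp (I * z) = cexp (z * I) * (cexp (I * (y - z : ℝ)) - 1) := by
      rw [mul_sub, ← Complex.exp_add, mul_one, mul_comm I (z : ℂ)]
      congr 2
      push_cast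
      ring
    rw [this, norm_mul, Complex.norm_exp_ofReal_mul_I, one_mul]
    exact Real.norm_exp_I_mul_ofReal_sub_one_le
  rw [dist_eq_norm, dist_eq_norm, ← integral_sub (hi Y) (hi Z), NNReal.coe_one, one_mul]
  calc ‖∫ ω, cexp (I * Y ω) - cexp (I * Z ω) ∂P‖
      ≤ ∫ ω, ‖(Y - Z : Lp ℝ 2 P) ω‖ ∂P := by
        refine norm_integral_le_of_norm_le hD.norm ?_
        filter_upwards [Lp.coeFn_sub Y Z] with ω hω
        rw [hω]
        exact hpt _ _
    _ = (eLpNorm (Y - Z : Lp ℝ 2 P) 1 P).toReal := by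
        rw [integral_norm_eq_lintegral_enorm hD.aestronglyMeasurable,
          eLpNorm_one_eq_lintegral_enorm]
    _ ≤ (eLpNorm (Y - Z : Lp ℝ 2 P) 2 P).toReal :=
        ENNReal.toReal_mono (Lp.memLp (Y - Z)).2.ne
          (eLpNorm_le_eLpNorm_of_exponent_le one_le_two hD.aestronglyMeasurable)
    _ = ‖Y - Z‖ := (Lp.norm_def _).symm

/-- The elements of `L²` whose characteristic function at `1` is that of a centred Gaussian variable
form a closed set. -/
lemma isClosed_setOf_integral_exp_eq :
    IsClosed {Y : Lp ℝ 2 P | ∫ ω, cexp (I * Y ω) ∂P = cexp (-(‖Y‖ ^ 2 / 2 : ℝ))} :=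
  isClosed_eq lipschitzWith_integral_exp_I_mul.continuous (by fun_prop)

lemma hasLaw_gaussianReal_of_integral_exp_eq {Y : Lp ℝ 2 P}
    (h : ∀ u : ℝ, ∫ ω, cexp (I * (u • Y : Lp ℝ 2 P) ω) ∂P =
      cexp (-(‖(u • Y : Lp ℝ 2 P)‖ ^ 2 / 2 : ℝ))) :
    HasLaw Y (gaussianReal 0 (‖Y‖₊ ^ 2)) P := by
  have hm : AEMeasurable Y P := (Lp.aestronglyMeasurable Y).aemeasurable
  refine ⟨hm, ?_⟩
  have := Measure.isProbabilityMeasure_map hm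
  refine Measure.ext_of_charFun (funext fun u => ?_)
  rw [charFun_gaussianReal, charFun_apply_real, integral_map hm (by fun_prop)]
  have hu : ∫ ω, cexp (u * Y ω * I) ∂P = ∫ ω, cexp (I * (u • Y : Lp ℝ 2 P) ω) ∂P := by
    refine integral_congr_ae ?_
    filter_upwards [Lp.coeFn_smul u Y] with ω hω
    rw [hω]
    simp [mul_comm]
  rw [hu, h u, norm_smul]
  congr 1
  simp [mul_pow]
  ring

end Gaussian

end IntegratedBrownian

namespace IntegratedBrownian

/-! ### The isometry between frequency domain and noise space -/

lemma X_zero_apply {Ω : Type*} (B : ℝ≥0 → Ω → ℝ) (t : ℝ) (ω : Ω) :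
    X B 0 t ω = Real.exp (-(1 / 2) * t) * B (Real.exp t).toNNReal ω := by
  simp [X, W]

section Isometry

variable {Ω : Type*} [MeasurableSpace Ω] {P : Measure Ω} {B : ℝ≥0 → Ω → ℝ}

lemma isGaussianProcess_X_zero (hB : IsBrownianReal B P) : IsGaussianProcess (X B 0) P := by
  have h : X B 0 = fun t ω => Real.exp (-(1 / 2) * t) •
      (B ∘ fun t : ℝ => (Real.exp t).toNNReal) t ω := by
    funext t ω
    exact X_zero_apply B t ω
  rw [h]
  exact (hB.isGaussianProcess.comp_right _).smul _

lemma memLp_X_zero (hB : IsBrownianReal B P) (t : ℝ) : MemLp (X B 0 t) 2 P :=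
  ((isGaussianProcess_X_zero hB).hasGaussianLaw_eval t).memLp_two

lemma integral_X_zero (hB : IsBrownianReal B P) (t : ℝ) : ∫ ω, X B 0 t ω ∂P = 0 := by
  simp_rw [X_zero_apply]
  rw [integral_const_mul, hB.integral_eval, mul_zero]

lemma integral_X_zero_mul (hB : IsBrownianReal B P) (s t : ℝ) :
    ∫ ω, X B 0 s ω * X B 0 t ω ∂P = Real.exp (-(|t - s| / 2)) := by
  have := hB.isGaussianProcess.isProbabilityMeasure
  have hm : ∀ r, MemLp (B r) 2 P := fun r =>
    (hB.isGaussianProcess.hasGaussianLaw_eval r).memLp_two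
  have hcov := hB.covariance_eval (Real.exp s).toNNReal (Real.exp t).toNNReal
  rw [covariance_eq_sub (hm _) (hm _), hB.integral_eval, zero_mul, sub_zero] at hcov
  have h1 : ∀ ω, X B 0 s ω * X B 0 t ω = (Real.exp (-(1 / 2) * s) * Real.exp (-(1 / 2) * t)) *
      (B (Real.exp s).toNNReal * B (Real.exp t).toNNReal) ω := fun ω => by
    rw [X_zero_apply, X_zero_apply, Pi.mul_apply]
    ring
  simp_rw [h1]
  rw [integral_const_mul, hcov]
  rcases le_total s t with h | h
  · have h2 : (Real.exp s).toNNReal ≤ (Real.exp t).toNNReal :=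
      Real.toNNReal_le_toNNReal (Real.exp_le_exp.2 h)
    rw [min_eq_left h2, Real.coe_toNNReal _ (Real.exp_pos _).le, ← Real.exp_add, ← Real.exp_add,
      abs_of_nonneg (by linarith)]
    congr 1
    ring
  · have h2 : (Real.exp t).toNNReal ≤ (Real.exp s).toNNReal :=
      Real.toNNReal_le_toNNReal (Real.exp_le_exp.2 h)
    rw [min_eq_right h2, Real.coe_toNNReal _ (Real.exp_pos _).le, ← Real.exp_add, ← Real.exp_add,
      abs_of_nonpos (by linarith)]
    congr 1
    ring

/-- The isometry `L²(dv) → L²(P)` that carries `H₀(v) exp (ivt)` to `√(2π) X₀(t)`: up to the factor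
`√(2π)`, the stochastic integral with respect to the spectral noise of `X₀`. -/
lemma exists_spectral_isometry (hB : IsBrownianReal B P) :
    ∃ U : Lp ℂ 2 (volume : Measure ℝ) →ₗᵢ[ℂ] Lp ℂ 2 P,
      ∀ t, U (spectralFun 0 t) =ᵐ[P] fun ω => ((√(2 * Real.pi) * X B 0 t ω : ℝ) : ℂ) := by
  have hm : ∀ t, MemLp (fun ω => ((√(2 * Real.pi) * X B 0 t ω : ℝ) : ℂ)) 2 P := fun t =>
    ((memLp_X_zero hB t).const_mul _).ofReal
  have hgram : ∀ s t, inner ℂ (spectralFun 0 s) (spectralFun 0 t) =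
      inner ℂ ((hm s).toLp _) ((hm t).toLp _) := fun s t => by
    rw [inner_spectralFun_zero, L2.inner_def]
    have h1 : ∫ ω, inner ℂ ((hm s).toLp _ ω) ((hm t).toLp _ ω) ∂P =
        ∫ ω, ((2 * Real.pi * (X B 0 s ω * X B 0 t ω) : ℝ) : ℂ) ∂P := by
      refine integral_congr_ae ?_
      filter_upwards [(hm s).coeFn_toLp, (hm t).coeFn_toLp] with ω h1 h2
      rw [h1, h2, RCLike.inner_apply, conj_ofReal, ← ofReal_mul]
      congr 1
      have := Real.mul_self_sqrt (show 0 ≤ 2 * Real.pi by positivity)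
      linear_combination (X B 0 s ω * X B 0 t ω) * this
    rw [h1, integral_complex_ofReal, integral_const_mul, integral_X_zero_mul hB]
    push_cast
    rfl
  obtain ⟨U, hU⟩ := exists_linearIsometry_of_inner_eq (spectralFun 0) (fun t => (hm t).toLp _)
    hgram dense_span_spectralFun_zero
  exact ⟨U, fun t => by rw [hU]; exact (hm t).coeFn_toLp⟩

variable {U : Lp ℂ 2 (volume : Measure ℝ) →ₗᵢ[ℂ] Lp ℂ 2 P}

/-- The isometry intertwines `F ↦ conj F(-·)` with complex conjugation, because `X₀` is real. -/
lemma spectral_isometry_conj_comp_neg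
    (hU : ∀ t, U (spectralFun 0 t) =ᵐ[P] fun ω => ((√(2 * Real.pi) * X B 0 t ω : ℝ) : ℂ))
    (F G : Lp ℂ 2 (volume : Measure ℝ)) (hFG : ∀ᵐ v, G v = conj (F (-v))) :
    U G =ᵐ[P] fun ω => conj (U F ω) := by
  set C₁ : Lp ℂ 2 (volume : Measure ℝ) →L[ℝ] Lp ℂ 2 (volume : Measure ℝ) :=
    conjCLE.toContinuousLinearMap.compLpL 2 volume ∘L
      (Lp.compMeasurePreservingₗᵢ ℝ (fun v : ℝ => -v)
        (Measure.measurePreserving_neg volume)).toContinuousLinearMap with hC₁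
  set C₂ : Lp ℂ 2 P →L[ℝ] Lp ℂ 2 P := conjCLE.toContinuousLinearMap.compLpL 2 P with hC₂
  have h1 : ∀ F, C₁ F =ᵐ[volume] fun v => conj (F (-v)) := fun F => by
    have e1 := conjCLE.toContinuousLinearMap.coeFn_compLpL (p := 2) (μ := volume)
      (Lp.compMeasurePreserving (fun v : ℝ => -v) (Measure.measurePreserving_neg volume) F)
    have e2 := Lp.coeFn_compMeasurePreserving F
      (Measure.measurePreserving_neg (volume : Measure ℝ))
    filter_upwards [e1, e2] with v e1 e2
    refine e1.trans ?_
    rw [e2]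
    simp
  have h2 : ∀ Z, C₂ Z =ᵐ[P] fun ω => conj (Z ω) := fun Z =>
    conjCLE.toContinuousLinearMap.coeFn_compLpL Z
  have hs1 : ∀ (a : ℂ) F, C₁ (a • F) = conj a • C₁ F := fun a F => by
    refine Lp.ext ?_
    have hq := (Measure.measurePreserving_neg (volume : Measure ℝ)).quasiMeasurePreserving.ae
      (Lp.coeFn_smul a F)
    filter_upwards [h1 (a • F), h1 F, Lp.coeFn_smul (conj a) (C₁ F), hq] with v e1 e2 e3 e4
    rw [e1, e3, e4]
    simp [e2]
  have hs2 : ∀ (a : ℂ) Z, C₂ (a • Z) = conj a • C₂ Z := fun a Z => by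
    refine Lp.ext ?_
    filter_upwards [h2 (a • Z), h2 Z, Lp.coeFn_smul (conj a) (C₂ Z), Lp.coeFn_smul a Z]
      with ω e1 e2 e3 e4
    rw [e1, e3, e4]
    simp [e2]
  have key : ∀ F, U (C₁ F) = C₂ (U F) := by
    have hd := Submodule.dense_iff_topologicalClosure_eq_top.2 dense_span_spectralFun_zero
    refine fun F => hd.induction (P := fun F => U (C₁ F) = C₂ (U F)) (fun F hF => ?_)
      (isClosed_eq (U.continuous.comp C₁.continuous) (C₂.continuous.comp U.continuous)) F
    refine Submodule.span_induction (p := fun F _ => U (C₁ F) = C₂ (U F)) ?_ (by simp)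
      (fun F G _ _ hF hG => by simp [hF, hG])
      (fun a F _ hF => by rw [hs1, map_smul, hF, map_smul, hs2]) hF
    rintro _ ⟨t, rfl⟩
    have e1 : C₁ (spectralFun 0 t) = spectralFun 0 t := by
      refine Lp.ext ?_
      have hq := (Measure.measurePreserving_neg (volume : Measure ℝ)).quasiMeasurePreserving.ae
        (coeFn_spectralFun 0 t)
      filter_upwards [h1 (spectralFun 0 t), coeFn_spectralFun 0 t, hq] with v e1 e2 e3
      rw [e1, e2, e3, map_mul, H_neg, conj_conj, conj_exp_I_mul]
      congr 2
      push_cast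
      ring
    rw [e1]
    refine Lp.ext ?_
    filter_upwards [h2 (U (spectralFun 0 t)), hU t] with ω e2 e3
    rw [e2, e3, conj_ofReal]
  have hG : G = C₁ F := by
    refine Lp.ext ?_
    filter_upwards [hFG, h1 F] with v e1 e2
    rw [e1, e2]
  rw [hG, key]
  exact h2 _

variable [IsProbabilityMeasure P]

/-- The real part of an element in the range of the isometry is a centred Gaussian variable: this
holds for linear combinations of the `X₀(t)`, and the condition is closed in `L²`. -/
lemma exists_hasLaw_re_spectral_isometry (hB : IsBrownianReal B P)
    (hU : ∀ t, U (spectralFun 0 t) =ᵐ[P] fun ω => ((√(2 * Real.pi) * X B 0 t ω : ℝ) : ℂ))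
    (F : Lp ℂ 2 (volume : Measure ℝ)) :
    ∃ v : ℝ≥0, HasLaw (fun ω => (U F ω).re) (gaussianReal 0 v) P := by
  set R : Lp ℂ 2 (volume : Measure ℝ) → Lp ℝ 2 P := fun F => reCLM.compLpL 2 P (U F) with hR
  have hRc : Continuous R := (reCLM.compLpL 2 P).continuous.comp U.continuous
  have hRe : ∀ F, R F =ᵐ[P] fun ω => (U F ω).re := fun F => reCLM.coeFn_compLpL (U F)
  have key : ∀ F, ∫ ω, cexp (I * R F ω) ∂P = cexp (-(‖R F‖ ^ 2 / 2 : ℝ)) := by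
    have hcl : IsClosed {F | ∫ ω, cexp (I * R F ω) ∂P = cexp (-(‖R F‖ ^ 2 / 2 : ℝ))} :=
      isClosed_setOf_integral_exp_eq.preimage hRc
    have hd := Submodule.dense_iff_topologicalClosure_eq_top.2 dense_span_spectralFun_zero
    refine fun F => hd.induction (P := fun F => ∫ ω, cexp (I * R F ω) ∂P =
      cexp (-(‖R F‖ ^ 2 / 2 : ℝ))) (fun F hF => ?_) hcl F
    obtain ⟨a, rfl⟩ := (Finsupp.mem_span_range_iff_exists_finsupp).1 hF
    have hsum : R (a.sum fun t c => c • spectralFun 0 t) =ᵐ[P]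
        fun ω => ∑ t : a.support, (√(2 * Real.pi) * (a t).re) * X B 0 t ω := by
      have h1 : U (a.sum fun t c => c • spectralFun 0 t) =ᵐ[P]
          fun ω => ∑ t ∈ a.support, a t * U (spectralFun 0 t) ω := by
        simp only [Finsupp.sum, map_sum, map_smul]
        have h2 : ∀ᵐ ω ∂P, ∀ t ∈ a.support, (a t • U (spectralFun 0 t) : Lp ℂ 2 P) ω =
            a t * U (spectralFun 0 t) ω := by
          rw [Filter.eventually_all_finset]
          intro t _
          filter_upwards [Lp.coeFn_smul (a t) (U (spectralFun 0 t))] with ω hω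
          simp [hω]
        filter_upwards [Lp.coeFn_finsetSum a.support fun t => (a t • U (spectralFun 0 t) : Lp ℂ 2 P),
          h2] with ω hω h2
        rw [hω, Finset.sum_apply]
        exact Finset.sum_congr rfl h2
      have h3 : ∀ᵐ ω ∂P, ∀ t ∈ a.support, U (spectralFun 0 t) ω =
          ((√(2 * Real.pi) * X B 0 t ω : ℝ) : ℂ) := by
        rw [Filter.eventually_all_finset]
        exact fun t _ => hU t
      filter_upwards [hRe _, h1, h3] with ω e1 e2 e3
      rw [e1, e2, Complex.re_sum, ← Finset.sum_coe_sort a.support]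
      refine Finset.sum_congr rfl fun t _ => ?_
      rw [e3 t t.2, Complex.re_mul_ofReal]
      ring
    have hG : HasGaussianLaw (fun ω => ∑ t : a.support,
        (√(2 * Real.pi) * (a t).re) * X B 0 t ω) P := by
      have h := ((isGaussianProcess_X_zero hB).hasGaussianLaw a.support).map_fun
        (∑ t : a.support, (√(2 * Real.pi) * (a t).re) • ContinuousLinearMap.proj (R := ℝ) t)
      convert! h using 2 with ω
      simp [Finset.restrict]
    refine integral_exp_eq_of_hasGaussianLaw (hG.congr hsum.symm) ?_
    rw [integral_congr_ae hsum, integral_finsetSum Finset.univ fun (t : a.support) _ =>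
      ((memLp_X_zero hB (t : ℝ)).integrable one_le_two).const_mul
        (√(2 * Real.pi) * (a (t : ℝ)).re)]
    simp [integral_const_mul, integral_X_zero hB]
  have hsmul : ∀ u : ℝ, R ((u : ℂ) • F) = u • R F := fun u => by
    have : U ((u : ℂ) • F) = u • U F := by
      rw [map_smul]
      exact Complex.coe_smul u (U F)
    simp only [hR]
    rw [this, map_smul]
  refine ⟨‖R F‖₊ ^ 2, (hasLaw_gaussianReal_of_integral_exp_eq fun u => ?_).congr (hRe F).symm⟩
  rw [← hsmul u]
  exact key _

/-- Elements of the range of the isometry are jointly Gaussian. -/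
lemma hasGaussianLaw_spectral_isometry (hB : IsBrownianReal B P)
    (hU : ∀ t, U (spectralFun 0 t) =ᵐ[P] fun ω => ((√(2 * Real.pi) * X B 0 t ω : ℝ) : ℂ))
    {κ : Type*} [Fintype κ] (F : κ → Lp ℂ 2 (volume : Measure ℝ)) (Y : κ → Ω → ℂ)
    (hY : ∀ k, Y k =ᵐ[P] U (F k)) : HasGaussianLaw (fun ω k => Y k ω) P := by
  classical
  have hm : AEMeasurable (fun ω k => Y k ω) P := aemeasurable_pi_lambda _ fun k =>
    (Lp.aestronglyMeasurable (U (F k))).aemeasurable.congr (hY k).symm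
  refine ⟨isGaussian_of_map_eq_gaussianReal fun L => ?_⟩
  -- a real-linear functional of `(Yₖ)` is the real part of a complex-linear one
  set c : κ → ℂ := fun k => L (Pi.single k 1) - L (Pi.single k I) * I with hc
  have hL : ∀ y : κ → ℂ, L y = (∑ k, c k * y k).re := fun y => by
    have h1 : y = ∑ k, ((y k).re • (Pi.single k 1 : κ → ℂ) + (y k).im • (Pi.single k I : κ → ℂ)) := by
      funext j
      simp only [Finset.sum_apply, Pi.add_apply, Pi.smul_apply, Pi.single_apply]
      rw [Finset.sum_eq_single j (fun b _ hb => by simp [Ne.symm hb]) (by simp)]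
      simp [Complex.re_add_im]
    conv_lhs => rw [h1]
    rw [map_sum, Complex.re_sum]
    refine Finset.sum_congr rfl fun k _ => ?_
    simp [hc]
    ring
  obtain ⟨v, hv⟩ := exists_hasLaw_re_spectral_isometry hB hU (∑ k, c k • F k)
  refine ⟨0, v, ?_⟩
  rw [AEMeasurable.map_map_of_aemeasurable (by fun_prop) hm, ← hv.map_eq]
  refine Measure.map_congr ?_
  have h2 : ∀ᵐ ω ∂P, ∀ k, (c k • U (F k) : Lp ℂ 2 P) ω = c k * U (F k) ω := by
    rw [ae_all_iff]
    intro k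
    filter_upwards [Lp.coeFn_smul (c k) (U (F k))] with ω hω
    simp [hω]
  filter_upwards [ae_all_iff.2 hY, h2,
    Lp.coeFn_finsetSum Finset.univ fun k => (c k • U (F k) : Lp ℂ 2 P)] with ω e1 e2 e3
  simp only [Function.comp_apply, hL, map_sum, map_smul]
  rw [e3, Finset.sum_apply]
  simp only [e1, e2]

lemma integral_spectral_isometry (hB : IsBrownianReal B P)
    (hU : ∀ t, U (spectralFun 0 t) =ᵐ[P] fun ω => ((√(2 * Real.pi) * X B 0 t ω : ℝ) : ℂ))
    (F : Lp ℂ 2 (volume : Measure ℝ)) : ∫ ω, U F ω ∂P = 0 := by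
  have hre : ∀ F, ∫ ω, (U F ω).re ∂P = 0 := fun F => by
    obtain ⟨v, hv⟩ := exists_hasLaw_re_spectral_isometry hB hU F
    rw [hv.integral_eq, integral_id_gaussianReal]
  have hint : Integrable (U F) P := (Lp.memLp (U F)).integrable one_le_two
  have him : ∫ ω, (U F ω).im ∂P = 0 := by
    rw [← hre ((-I) • F)]
    refine integral_congr_ae ?_
    rw [map_smul]
    filter_upwards [Lp.coeFn_smul (-I) (U F)] with ω hω
    rw [hω]
    simp
  apply Complex.ext
  · have := integral_re hint
    simp only [RCLike.re_to_complex] at this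
    rw [← this, hre, zero_re]
  · have := integral_im hint
    simp only [RCLike.im_to_complex] at this
    rw [← this, him, zero_im]

end Isometry

end IntegratedBrownian

namespace IntegratedBrownian

/-! ### Spectral representation of the integrated processes -/

lemma tendsto_riemann_sum {E : Type*} [NormedAddCommGroup E] [NormedSpace ℝ E] [CompleteSpace E]
    {f : ℝ → E} (hf : Continuous f) {s : ℝ} (hs : 0 ≤ s) :
    Filter.Tendsto (fun N : ℕ => ∑ i ∈ Finset.range (N + 1), (s / (N + 1)) • f (s / (N + 1) * i))
      Filter.atTop (nhds (∫ x in (0 : ℝ)..s, f x)) := by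
  have hint : ∀ a b, IntervalIntegrable f volume a b := fun a b => hf.intervalIntegrable a b
  rw [Metric.tendsto_atTop]
  intro ε hε
  have huc := isCompact_Icc.uniformContinuousOn_of_continuous (hf.continuousOn (s := Set.Icc 0 s))
  rw [Metric.uniformContinuousOn_iff] at huc
  obtain ⟨δ, hδ, hδ'⟩ := huc (ε / (s + 1)) (by positivity)
  obtain ⟨N₀, hN₀⟩ := exists_nat_gt (s / δ)
  refine ⟨N₀, fun N hN => ?_⟩
  set h : ℝ := s / (N + 1) with hh
  have hN1 : (0 : ℝ) < N + 1 := by positivity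
  have hh0 : 0 ≤ h := by positivity
  have hhN : h * (N + 1) = s := div_mul_cancel₀ _ hN1.ne'
  have hhδ : h < δ := by
    rw [hh, div_lt_iff₀ hN1]
    rw [div_lt_iff₀ hδ] at hN₀
    have : (N₀ : ℝ) ≤ N := by exact_mod_cast hN
    nlinarith
  have hsplit : ∫ x in (0 : ℝ)..s, f x =
      ∑ i ∈ Finset.range (N + 1), ∫ x in (h * i)..(h * (i + 1)), f x := by
    have := intervalIntegral.sum_integral_adjacent_intervals (a := fun i : ℕ => h * i)
      (n := N + 1) (f := f) (μ := volume) fun k _ => hint _ _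
    simp only [Nat.cast_zero, mul_zero, Nat.cast_add, Nat.cast_one, hhN] at this
    exact this.symm
  have hterm : ∀ i ∈ Finset.range (N + 1),
      ‖h • f (h * i) - ∫ x in (h * i)..(h * (i + 1)), f x‖ ≤ ε / (s + 1) * h := fun i hi => by
    have hiN : (i : ℝ) + 1 ≤ N + 1 := by
      have := Finset.mem_range.1 hi
      exact_mod_cast this
    have hi0 : (0 : ℝ) ≤ i := Nat.cast_nonneg i
    have hle : h * i ≤ h * (i + 1) := by nlinarith
    have hconst : h • f (h * i) = ∫ _ in (h * i)..(h * (i + 1)), f (h * i) := by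
      rw [intervalIntegral.integral_const]
      congr 1
      ring
    rw [hconst, ← intervalIntegral.integral_sub (by simp) (hint _ _)]
    refine (intervalIntegral.norm_integral_le_of_norm_le_const (C := ε / (s + 1))
      fun x hx => ?_).trans (le_of_eq ?_)
    · rw [Set.uIoc_of_le hle] at hx
      have hend : h * (i + 1) ≤ s := by
        rw [← hhN]
        exact mul_le_mul_of_nonneg_left hiN hh0
      have hstart : 0 ≤ h * i := by positivity
      rw [← dist_eq_norm]
      refine (hδ' _ ⟨hstart, by linarith [hx.1, hx.2]⟩ _ ⟨by linarith [hx.1], by linarith [hx.2]⟩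
        ?_).le
      rw [Real.dist_eq, abs_sub_lt_iff]
      constructor <;> nlinarith [hx.1, hx.2]
    · rw [show h * (i + 1) - h * i = h by ring, abs_of_nonneg hh0]
  rw [dist_eq_norm, hsplit, ← Finset.sum_sub_distrib]
  calc ‖∑ i ∈ Finset.range (N + 1), (h • f (h * i) - ∫ x in (h * i)..(h * (i + 1)), f x)‖
      ≤ ∑ i ∈ Finset.range (N + 1), ε / (s + 1) * h := norm_sum_le_of_le _ hterm
    _ = ε / (s + 1) * s := by
        rw [Finset.sum_const, Finset.card_range, nsmul_eq_mul, ← hhN]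
        push_cast
        ring
    _ < ε := by
        rw [div_mul_eq_mul_div, div_lt_iff₀ (by linarith)]
        nlinarith

lemma tendsto_Lp_two_of_dominated {α : Type*} [MeasurableSpace α] {μ : Measure α}
    {G : ℕ → Lp ℂ 2 μ} {F : Lp ℂ 2 μ} {b : α → ℝ} (hb : MemLp b 2 μ)
    (hbound : ∀ n, ∀ᵐ x ∂μ, ‖G n x‖ ≤ b x)
    (hlim : ∀ᵐ x ∂μ, Filter.Tendsto (fun n => G n x) Filter.atTop (nhds (F x))) :
    Filter.Tendsto G Filter.atTop (nhds F) := by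
  have hsq : ∀ Z : Lp ℂ 2 μ, ‖Z‖ ^ 2 = ∫ x, ‖Z x‖ ^ 2 ∂μ := fun Z => by
    have h1 : ((‖Z‖ ^ 2 : ℝ) : ℂ) = ((∫ x, ‖Z x‖ ^ 2 ∂μ : ℝ) : ℂ) := by
      have h2 := inner_self_eq_norm_sq_to_K (𝕜 := ℂ) Z
      rw [L2.inner_def] at h2
      push_cast
      refine h2.symm.trans ?_
      rw [← integral_complex_ofReal]
      refine integral_congr_ae (Filter.Eventually.of_forall fun x => ?_)
      simp only
      rw [inner_self_eq_norm_sq_to_K]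
      push_cast
      rfl
    exact_mod_cast h1
  rw [tendsto_iff_norm_sub_tendsto_zero]
  have hconv : Filter.Tendsto (fun n => ∫ x, ‖(G n - F : Lp ℂ 2 μ) x‖ ^ 2 ∂μ) Filter.atTop
      (nhds (∫ _, (0 : ℝ) ∂μ)) := by
    refine tendsto_integral_of_dominated_convergence (fun x => (2 * b x) ^ 2) (fun n => ?_) ?_
      (fun n => ?_) ?_
    · exact (Lp.aestronglyMeasurable (G n - F)).norm.pow 2
    · exact (hb.const_mul 2).integrable_sq
    · filter_upwards [Lp.coeFn_sub (G n) F, hbound n, hlim, ae_all_iff.2 hbound]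
        with x e1 e2 e3 e4
      have hF : ‖F x‖ ≤ b x :=
        le_of_tendsto e3.norm (Filter.Eventually.of_forall e4)
      rw [e1, Pi.sub_apply, Real.norm_of_nonneg (by positivity)]
      have := norm_sub_le (G n x) (F x)
      exact pow_le_pow_left₀ (norm_nonneg _) (by linarith) 2
    · filter_upwards [hlim, ae_all_iff.2 fun n => Lp.coeFn_sub (G n) F] with x e1 e2
      simp only [e2, Pi.sub_apply]
      have h3 := ((e1.sub_const (F x)).norm).pow 2
      simpa using h3
  rw [integral_zero] at hconv
  simp_rw [← hsq] at hconv
  have := hconv.sqrt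
  simpa [Real.sqrt_sq (norm_nonneg _)] using this

lemma continuous_W {Ω : Type*} {B : ℝ≥0 → Ω → ℝ} {ω : Ω} (h : Continuous (B · ω)) (n : ℕ) :
    Continuous fun t => W B n t ω := by
  induction n with
  | zero => exact h.comp continuous_real_toNNReal
  | succ n ih => exact intervalIntegral.continuous_primitive (fun a b => ih.intervalIntegrable a b) 0

/-- The transfer function of `Wₙ(s)`, that is, `s ^ (n + 1/2) Hₙ(v) exp (iv log s)`. -/
noncomputable def transferW (n : ℕ) (s v : ℝ) : ℂ :=
  (s : ℂ) ^ ((n : ℂ) + 1 / 2 + I * v) * H n v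

lemma norm_transferW_le {n : ℕ} {r s : ℝ} (hr : 0 ≤ r) (hrs : r ≤ s) (v : ℝ) :
    ‖transferW n r v‖ ≤ s ^ ((n : ℝ) + 1 / 2) * ‖H 0 v‖ := by
  have hre : ((n : ℂ) + 1 / 2 + I * v).re = (n : ℝ) + 1 / 2 := by simp
  rw [transferW, norm_mul, norm_cpow_eq_rpow_re_of_nonneg hr (by rw [hre]; positivity), hre]
  exact mul_le_mul (Real.rpow_le_rpow hr hrs (by positivity)) (norm_H_le n v) (norm_nonneg _)
    (Real.rpow_nonneg (hr.trans hrs) _)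

lemma memLp_transferW (n : ℕ) {s : ℝ} (hs : 0 ≤ s) : MemLp (transferW n s) 2 := by
  refine ((memLp_H 0).norm.const_mul (s ^ ((n : ℝ) + 1 / 2))).mono' ?_
    (Filter.Eventually.of_forall (norm_transferW_le hs le_rfl))
  refine Continuous.aestronglyMeasurable (Continuous.mul ?_ (continuous_H n))
  exact Continuous.const_cpow (by fun_prop)
    (Or.inr (natCast_add_half_add_ne_zero n))

lemma continuous_transferW (n : ℕ) (v : ℝ) : Continuous fun s => transferW n s v := by
  have hre : 0 < ((n : ℂ) + 1 / 2 + I * v).re := by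
    simp
    positivity
  exact (continuous_ofReal_cpow_const hre).mul continuous_const

lemma integral_transferW (n : ℕ) (s v : ℝ) :
    ∫ r in (0 : ℝ)..s, transferW n r v = transferW (n + 1) s v := by
  have hre : -1 < ((n : ℂ) + 1 / 2 + I * v).re := by
    simp
    linarith [Nat.cast_nonneg (α := ℝ) n]
  have he : (n : ℂ) + 1 / 2 + I * v + 1 = ((n + 1 : ℕ) : ℂ) + 1 / 2 + I * v := by
    push_cast
    ring
  simp only [transferW]
  rw [intervalIntegral.integral_mul_const, integral_cpow (Or.inl hre), he, H_succ, ofReal_zero,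
    zero_cpow (natCast_add_half_add_ne_zero (n + 1) v)]
  ring

lemma transferW_exp (n : ℕ) (t v : ℝ) :
    transferW n (Real.exp t) v = Real.exp ((n + 1 / 2) * t) * (H n v * cexp (I * v * t)) := by
  rw [transferW, ofReal_exp, ofReal_exp,
    cpow_def_of_ne_zero (Complex.exp_ne_zero _), ← ofReal_exp, ← ofReal_log (Real.exp_pos t).le,
    Real.log_exp, mul_left_comm, ← Complex.exp_add, mul_comm]
  congr 2
  push_cast
  ring

section Representation

variable {Ω : Type*} [MeasurableSpace Ω] {P : Measure Ω} {B : ℝ≥0 → Ω → ℝ}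
  {U : Lp ℂ 2 (volume : Measure ℝ) →ₗᵢ[ℂ] Lp ℂ 2 P}

lemma spectral_isometry_transferW_zero (hB : IsBrownianReal B P)
    (hU : ∀ t, U (spectralFun 0 t) =ᵐ[P] fun ω => ((√(2 * Real.pi) * X B 0 t ω : ℝ) : ℂ))
    {s : ℝ} (hs : 0 ≤ s) :
    U ((memLp_transferW 0 hs).toLp _) =ᵐ[P] fun ω => ((√(2 * Real.pi) * W B 0 s ω : ℝ) : ℂ) := by
  rcases hs.eq_or_lt with rfl | hpos
  · have h0 : (memLp_transferW 0 le_rfl).toLp (transferW 0 0) = 0 := by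
      rw [Lp.eq_zero_iff_ae_eq_zero]
      filter_upwards [(memLp_transferW 0 le_rfl).coeFn_toLp] with v hv
      have := natCast_add_half_add_ne_zero 0 v
      rw [hv, transferW, ofReal_zero, zero_cpow this, zero_mul, Pi.zero_apply]
    rw [h0, map_zero]
    filter_upwards [Lp.coeFn_zero ℂ 2 P, hB.eval_zero_ae_eq_zero] with ω h1 h2
    rw [h1]
    simp [W, h2]
  · obtain ⟨t, rfl⟩ : ∃ t, Real.exp t = s := ⟨Real.log s, Real.exp_log hpos⟩
    have h1 : (memLp_transferW 0 hs).toLp (transferW 0 (Real.exp t)) =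
        (Real.exp (1 / 2 * t) : ℂ) • spectralFun 0 t := by
      refine Lp.ext ?_
      filter_upwards [(memLp_transferW 0 hs).coeFn_toLp, coeFn_spectralFun 0 t,
        Lp.coeFn_smul (Real.exp (1 / 2 * t) : ℂ) (spectralFun 0 t)] with v e1 e2 e3
      rw [e1, e3, Pi.smul_apply, e2, transferW_exp]
      simp
    rw [h1, map_smul]
    filter_upwards [hU t, Lp.coeFn_smul (Real.exp (1 / 2 * t) : ℂ) (U (spectralFun 0 t))]
      with ω e1 e2
    rw [e2, Pi.smul_apply, e1, smul_eq_mul, ← ofReal_mul, X_zero_apply, W]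
    congr 1
    have : Real.exp (1 / 2 * t) * Real.exp (-(1 / 2) * t) = 1 := by
      rw [← Real.exp_add, ← Real.exp_zero]
      congr 1
      ring
    linear_combination (√(2 * Real.pi) * B (Real.exp t).toNNReal ω) * this

/-- The isometry maps the transfer function of `Wₙ(s)` to `√(2π) Wₙ(s)`. Integration in time is
carried through as a limit of Riemann sums: they converge almost surely by continuity of the paths,
and in `L²(dv)` by dominated convergence. -/
lemma spectral_isometry_transferW [IsProbabilityMeasure P] (hB : IsBrownianReal B P)
    (hU : ∀ t, U (spectralFun 0 t) =ᵐ[P] fun ω => ((√(2 * Real.pi) * X B 0 t ω : ℝ) : ℂ))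
    (n : ℕ) {s : ℝ} (hs : 0 ≤ s) :
    U ((memLp_transferW n hs).toLp _) =ᵐ[P] fun ω => ((√(2 * Real.pi) * W B n s ω : ℝ) : ℂ) := by
  induction n generalizing s with
  | zero => exact spectral_isometry_transferW_zero hB hU hs
  | succ n ih =>
    have hx : ∀ N i : ℕ, 0 ≤ s / (N + 1) * i := fun N i => by positivity
    set G : ℕ → Lp ℂ 2 (volume : Measure ℝ) := fun N => ∑ i ∈ Finset.range (N + 1),
      ((s / (N + 1) : ℝ) : ℂ) • (memLp_transferW n (hx N i)).toLp _ with hG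
    have hGv : ∀ N, G N =ᵐ[volume] fun v => ∑ i ∈ Finset.range (N + 1),
        (s / (N + 1)) • transferW n (s / (N + 1) * i) v := fun N => by
      have h1 : ∀ᵐ v, ∀ i ∈ Finset.range (N + 1),
          (((s / (N + 1) : ℝ) : ℂ) • (memLp_transferW n (hx N i)).toLp _ :
            Lp ℂ 2 (volume : Measure ℝ)) v =
          (s / (N + 1)) • transferW n (s / (N + 1) * i) v := by
        rw [Filter.eventually_all_finset]
        intro i _
        filter_upwards [Lp.coeFn_smul ((s / (N + 1) : ℝ) : ℂ)
          ((memLp_transferW n (hx N i)).toLp _), (memLp_transferW n (hx N i)).coeFn_toLp]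
          with v e1 e2
        rw [e1, Pi.smul_apply, e2, Complex.coe_smul]
      filter_upwards [h1, Lp.coeFn_finsetSum (Finset.range (N + 1)) fun i : ℕ =>
        (((s / (N + 1) : ℝ) : ℂ) • (memLp_transferW n (hx N i)).toLp _ :
            Lp ℂ 2 (volume : Measure ℝ))] with v e1 e2
      rw [e2, Finset.sum_apply]
      exact Finset.sum_congr rfl e1
    have hUG : ∀ N, U (G N) =ᵐ[P] fun ω => ((√(2 * Real.pi) * ∑ i ∈ Finset.range (N + 1),
        (s / (N + 1)) • W B n (s / (N + 1) * i) ω : ℝ) : ℂ) := fun N => by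
      have h1 : ∀ᵐ ω ∂P, ∀ i ∈ Finset.range (N + 1),
          (((s / (N + 1) : ℝ) : ℂ) • U ((memLp_transferW n (hx N i)).toLp _) : Lp ℂ 2 P) ω =
          ((√(2 * Real.pi) * ((s / (N + 1)) • W B n (s / (N + 1) * i) ω) : ℝ) : ℂ) := by
        rw [Filter.eventually_all_finset]
        intro i _
        filter_upwards [Lp.coeFn_smul ((s / (N + 1) : ℝ) : ℂ)
          (U ((memLp_transferW n (hx N i)).toLp _)), ih (hx N i)] with ω e1 e2
        rw [e1, Pi.smul_apply, e2, smul_eq_mul, smul_eq_mul, ← ofReal_mul]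
        congr 1
        ring
      simp only [hG, map_sum, map_smul]
      filter_upwards [h1, Lp.coeFn_finsetSum (Finset.range (N + 1)) fun i : ℕ =>
        (((s / (N + 1) : ℝ) : ℂ) • U ((memLp_transferW n (hx N i)).toLp _) : Lp ℂ 2 P)]
        with ω e1 e2
      rw [e2, Finset.sum_apply, Finset.sum_congr rfl e1, ← ofReal_sum, ← Finset.mul_sum]
    have hlim : Filter.Tendsto G Filter.atTop (nhds ((memLp_transferW (n + 1) hs).toLp _)) := by
      refine tendsto_Lp_two_of_dominated
        (((memLp_H 0).norm.const_mul (s ^ ((n : ℝ) + 1 / 2))).const_mul s) (fun N => ?_) ?_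
      · filter_upwards [hGv N] with v e1
        have hN1 : (0 : ℝ) < N + 1 := by positivity
        have hterm : ∀ i ∈ Finset.range (N + 1),
            ‖(s / (N + 1)) • transferW n (s / (N + 1) * i) v‖ ≤
              s / (N + 1) * (s ^ ((n : ℝ) + 1 / 2) * ‖H 0 v‖) := fun i hi => by
          have hi' : (i : ℝ) ≤ N + 1 := by
            have := (Finset.mem_range.1 hi).le
            exact_mod_cast this
          rw [norm_smul, Real.norm_of_nonneg (by positivity)]
          refine mul_le_mul_of_nonneg_left (norm_transferW_le (hx N i) ?_ v) (by positivity)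
          rw [div_mul_eq_mul_div, div_le_iff₀ hN1]
          exact mul_le_mul_of_nonneg_left hi' hs
        rw [e1]
        refine (norm_sum_le_of_le _ hterm).trans (le_of_eq ?_)
        rw [Finset.sum_const, Finset.card_range, nsmul_eq_mul]
        push_cast
        field_simp
      · filter_upwards [ae_all_iff.2 hGv, (memLp_transferW (n + 1) hs).coeFn_toLp] with v e1 e2
        rw [e2, ← integral_transferW]
        simp only [e1]
        exact tendsto_riemann_sum (continuous_transferW n v) hs
    have hm1 : TendstoInMeasure P (fun N => U (G N)) Filter.atTop
        (U ((memLp_transferW (n + 1) hs).toLp _)) :=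
      tendstoInMeasure_of_tendsto_Lp ((U.continuous.tendsto _).comp hlim)
    have hm2 : TendstoInMeasure P (fun N => U (G N)) Filter.atTop
        (fun ω => ((√(2 * Real.pi) * W B (n + 1) s ω : ℝ) : ℂ)) := by
      refine tendstoInMeasure_of_tendsto_ae (fun N => Lp.aestronglyMeasurable _) ?_
      filter_upwards [ae_all_iff.2 hUG, hB.cont] with ω e1 e2
      simp only [e1]
      exact (continuous_ofReal.tendsto _).comp
        ((tendsto_riemann_sum (continuous_W e2 n) hs).const_mul _)
    exact tendstoInMeasure_ae_unique hm1 hm2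

/-- The isometry maps `Hₙ(v) exp (ivt)` to `√(2π) Xₙ(t)`. -/
lemma spectral_isometry_spectralFun [IsProbabilityMeasure P] (hB : IsBrownianReal B P)
    (hU : ∀ t, U (spectralFun 0 t) =ᵐ[P] fun ω => ((√(2 * Real.pi) * X B 0 t ω : ℝ) : ℂ))
    (n : ℕ) (t : ℝ) :
    U (spectralFun n t) =ᵐ[P] fun ω => ((√(2 * Real.pi) * X B n t ω : ℝ) : ℂ) := by
  have hexp : Real.exp (-((n : ℝ) + 1 / 2) * t) * Real.exp (((n : ℝ) + 1 / 2) * t) = 1 := by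
    rw [← Real.exp_add, ← Real.exp_zero]
    congr 1
    ring
  have hs := (Real.exp_pos t).le
  have h1 : spectralFun n t = (Real.exp (-((n : ℝ) + 1 / 2) * t) : ℂ) •
      (memLp_transferW n hs).toLp (transferW n (Real.exp t)) := by
    refine Lp.ext ?_
    filter_upwards [(memLp_transferW n hs).coeFn_toLp, coeFn_spectralFun n t,
      Lp.coeFn_smul (Real.exp (-((n : ℝ) + 1 / 2) * t) : ℂ)
        ((memLp_transferW n hs).toLp (transferW n (Real.exp t)))] with v e1 e2 e3
    rw [e2, e3, Pi.smul_apply, e1, transferW_exp, smul_eq_mul, ← mul_assoc, ← ofReal_mul, hexp,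
      ofReal_one, one_mul]
  rw [h1, map_smul]
  filter_upwards [spectral_isometry_transferW hB hU n hs,
    Lp.coeFn_smul (Real.exp (-((n : ℝ) + 1 / 2) * t) : ℂ)
        (U ((memLp_transferW n hs).toLp (transferW n (Real.exp t))))] with ω e1 e2
  rw [e2, Pi.smul_apply, e1, smul_eq_mul, ← ofReal_mul, X]
  congr 1
  ring

end Representation

end IntegratedBrownian

namespace IntegratedBrownian

/-! ### The spectral noise -/

section Noise

variable {Ω : Type*} [MeasurableSpace Ω] {P : Measure Ω} {B : ℝ≥0 → Ω → ℝ}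

/-- The indicator function of a Borel set of finite measure as an element of `L²(dv)`. -/
noncomputable def indicatorFun (A : FiniteBorel) : Lp ℂ 2 (volume : Measure ℝ) :=
  indicatorConstLp 2 A.2.1 A.2.2.ne 1

lemma coeFn_indicatorFun (A : FiniteBorel) :
    indicatorFun A =ᵐ[volume] A.1.indicator fun _ => (1 : ℂ) :=
  indicatorConstLp_coeFn

/-- The random set function `A ↦ √(2π) U(1_A)` attached to an isometry `U : L²(dv) → L²(P)`. -/
noncomputable def noise (U : Lp ℂ 2 (volume : Measure ℝ) →ₗᵢ[ℂ] Lp ℂ 2 P) (A : FiniteBorel)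
    (ω : Ω) : ℂ :=
  √(2 * Real.pi) * U (indicatorFun A) ω

variable {U : Lp ℂ 2 (volume : Measure ℝ) →ₗᵢ[ℂ] Lp ℂ 2 P}

lemma isSpectralNoise_noise [IsProbabilityMeasure P] (hB : IsBrownianReal B P)
    (hU : ∀ t, U (spectralFun 0 t) =ᵐ[P] fun ω => ((√(2 * Real.pi) * X B 0 t ω : ℝ) : ℂ)) :
    IsSpectralNoise P (noise U) where
  gaussian := ⟨fun I => by
    refine hasGaussianLaw_spectral_isometry hB hU
      (fun A : I => (√(2 * Real.pi) : ℂ) • indicatorFun A) (fun A => noise U A) fun A => ?_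
    rw [map_smul]
    filter_upwards [Lp.coeFn_smul (√(2 * Real.pi) : ℂ) (U (indicatorFun A))] with ω hω
    rw [hω]
    rfl⟩
  mean_zero A := by
    simp only [noise]
    rw [integral_const_mul, integral_spectral_isometry hB hU, mul_zero]
  additive A A' C hd hC := by
    have h : indicatorFun C = indicatorFun A + indicatorFun A' := by
      refine Lp.ext ?_
      filter_upwards [coeFn_indicatorFun A, coeFn_indicatorFun A', coeFn_indicatorFun C,
        Lp.coeFn_add (indicatorFun A) (indicatorFun A')] with v e1 e2 e3 e4
      rw [e4, Pi.add_apply, e1, e2, e3, hC, Set.indicator_union_of_disjoint hd]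
    simp only [noise, h, map_add]
    filter_upwards [Lp.coeFn_add (U (indicatorFun A)) (U (indicatorFun A'))] with ω hω
    rw [hω, Pi.add_apply, mul_add]
  covariance A A' := by
    have h1 : inner ℂ (U (indicatorFun A')) (U (indicatorFun A)) =
        ((volume.real (A.1 ∩ A'.1) : ℝ) : ℂ) := by
      rw [U.inner_map_map, indicatorFun, indicatorFun,
        L2.inner_indicatorConstLp_one_indicatorConstLp_one A'.2.1 A.2.1 A'.2.2.ne A.2.2.ne,
        Set.inter_comm]
      rfl
    have h2 : ∀ ω, noise U A ω * conj (noise U A' ω) =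
        (2 * Real.pi : ℂ) * inner ℂ (U (indicatorFun A') ω) (U (indicatorFun A) ω) := fun ω => by
      have h3 : (√(2 * Real.pi) : ℂ) * √(2 * Real.pi) = 2 * Real.pi := by
        rw [← ofReal_mul, Real.mul_self_sqrt (by positivity)]
        push_cast
        rfl
      rw [noise, noise, map_mul, conj_ofReal, RCLike.inner_apply, ← h3]
      ring
    simp_rw [h2]
    rw [integral_const_mul, ← L2.inner_def, h1]
    push_cast
    rfl
  symmetric A A' hA := by
    have h := spectral_isometry_conj_comp_neg hU (indicatorFun A) (indicatorFun A') (by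
      have hq := (Measure.measurePreserving_neg (volume : Measure ℝ)).quasiMeasurePreserving.ae
        (coeFn_indicatorFun A)
      filter_upwards [coeFn_indicatorFun A', hq] with v e1 e2
      rw [e1, e2, hA]
      by_cases hv : -v ∈ A.1 <;> simp [Set.indicator, hv])
    filter_upwards [h] with ω hω
    rw [noise, noise, hω, map_mul, conj_ofReal]

lemma eLpNorm_linearIsometry (F : Lp ℂ 2 (volume : Measure ℝ)) :
    eLpNorm (U F) 2 P = eLpNorm F 2 volume := by
  rw [← Lp.enorm_def, ← Lp.enorm_def, ← ofReal_norm, ← ofReal_norm, U.norm_map]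

/-- Integration against `A ↦ √(2π) U(1_A)` is `F ↦ √(2π) U(F)`. -/
lemma isNoiseIntegral_noise {F : ℝ → ℂ} (hF : MemLp F 2) :
    IsNoiseIntegral P (noise U) F fun ω => √(2 * Real.pi) * U (hF.toLp F) ω := by
  refine ⟨hF, (Lp.memLp (U (hF.toLp F))).const_mul _, fun ε hε => ?_⟩
  set K : ℝ≥0∞ := ‖(√(2 * Real.pi) : ℂ)‖ₑ with hK
  obtain ⟨g, hg, hgm⟩ := hF.exists_simpleFunc_eLpNorm_sub_lt (by simp)
    (ε := min ε (ε / K)) (lt_min hε (ENNReal.div_pos hε.ne' enorm_ne_top)).ne'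
  set s : Finset ℂ := g.range.filter (· ≠ 0) with hs
  have hfin : ∀ c : s, volume (g ⁻¹' {(c : ℂ)}) < ∞ := fun c =>
    SimpleFunc.measure_preimage_lt_top_of_memLp (by simp) (by simp) g hgm _
      (Finset.mem_filter.1 c.2).2
  set A : s → FiniteBorel := fun c =>
    ⟨g ⁻¹' {(c : ℂ)}, g.measurableSet_preimage _, hfin c⟩ with hA
  have hsum : ∀ v, ∑ c : s, (A c).1.indicator (fun _ => (c : ℂ)) v = g v := fun v => by
    rw [Finset.sum_coe_sort s fun c : ℂ => (g ⁻¹' {c}).indicator (fun _ => c) v]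
    by_cases h0 : g v = 0
    · rw [h0]
      refine Finset.sum_eq_zero fun c hc => ?_
      have : c ≠ 0 := (Finset.mem_filter.1 hc).2
      simp [h0, this.symm]
    · rw [Finset.sum_eq_single (g v)]
      · simp
      · intro c _ hc
        simp [Ne.symm hc]
      · intro hc
        exact absurd (Finset.mem_filter.2 ⟨g.mem_range_self v, h0⟩) hc
  have hV : (hF.toLp F - ∑ c : s, (c : ℂ) • indicatorFun (A c) : Lp ℂ 2 (volume : Measure ℝ))
      =ᵐ[volume] fun v => F v - ∑ c : s, (A c).1.indicator (fun _ => (c : ℂ)) v := by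
    have h1 : ∀ᵐ v, ∀ c : s, ((c : ℂ) • indicatorFun (A c) : Lp ℂ 2 (volume : Measure ℝ)) v =
        (A c).1.indicator (fun _ => (c : ℂ)) v := by
      rw [ae_all_iff]
      intro c
      filter_upwards [Lp.coeFn_smul (c : ℂ) (indicatorFun (A c)), coeFn_indicatorFun (A c)]
        with v e1 e2
      rw [e1, Pi.smul_apply, e2]
      by_cases hv : v ∈ (A c).1 <;> simp [Set.indicator, hv]
    filter_upwards [Lp.coeFn_sub (hF.toLp F) (∑ c : s, (c : ℂ) • indicatorFun (A c)),
      Lp.coeFn_finsetSum Finset.univ fun c : s =>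
        ((c : ℂ) • indicatorFun (A c) : Lp ℂ 2 (volume : Measure ℝ)), h1, hF.coeFn_toLp]
      with v e1 e2 e3 e4
    rw [e1, Pi.sub_apply, e2, e4, Finset.sum_apply]
    simp only [e3]
  have hUV : (fun ω => √(2 * Real.pi) * U (hF.toLp F) ω - ∑ c : s, (c : ℂ) * noise U (A c) ω)
      =ᵐ[P] (√(2 * Real.pi) : ℂ) •
        ⇑(U (hF.toLp F - ∑ c : s, (c : ℂ) • indicatorFun (A c))) := by
    have h1 : ∀ᵐ ω ∂P, ∀ c : s, ((c : ℂ) • U (indicatorFun (A c)) : Lp ℂ 2 P) ω =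
        c * U (indicatorFun (A c)) ω := by
      rw [ae_all_iff]
      intro c
      filter_upwards [Lp.coeFn_smul (c : ℂ) (U (indicatorFun (A c)))] with ω e1
      rw [e1, Pi.smul_apply, smul_eq_mul]
    simp only [map_sub, map_sum, map_smul]
    filter_upwards [Lp.coeFn_sub (U (hF.toLp F)) (∑ c : s, (c : ℂ) • U (indicatorFun (A c))),
      Lp.coeFn_finsetSum Finset.univ fun c : s =>
        ((c : ℂ) • U (indicatorFun (A c)) : Lp ℂ 2 P), h1] with ω e1 e2 e3
    rw [Pi.smul_apply, e1, Pi.sub_apply, e2, Finset.sum_apply, smul_eq_mul, mul_sub,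
      Finset.mul_sum]
    simp only [e3, noise]
    congr 1
    exact Finset.sum_congr rfl fun c _ => by ring
  have hgs : eLpNorm (fun v => F v - ∑ c : s, (A c).1.indicator (fun _ => (c : ℂ)) v) 2 volume =
      eLpNorm (F - ⇑g) 2 volume := by
    congr 1
    funext v
    rw [hsum, Pi.sub_apply]
  set e := s.equivFin with he
  refine ⟨s.card, fun i => (e.symm i : ℂ), fun i => A (e.symm i), ?_, ?_⟩
  · have h1 : ∀ v, ∑ i, (A (e.symm i)).1.indicator (fun _ => (e.symm i : ℂ)) v =
        ∑ c : s, (A c).1.indicator (fun _ => (c : ℂ)) v := fun v =>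
      e.symm.sum_comp fun c : s => (A c).1.indicator (fun _ => (c : ℂ)) v
    simp_rw [h1]
    rw [hgs]
    exact hg.trans_le (min_le_left _ _)
  · have h1 : ∀ ω, ∑ i, (e.symm i : ℂ) * noise U (A (e.symm i)) ω =
        ∑ c : s, (c : ℂ) * noise U (A c) ω := fun ω =>
      e.symm.sum_comp fun c : s => (c : ℂ) * noise U (A c) ω
    simp_rw [h1]
    rw [eLpNorm_congr_ae hUV, eLpNorm_const_smul, eLpNorm_linearIsometry, eLpNorm_congr_ae hV, hgs,
      mul_comm]
    exact ENNReal.mul_lt_of_lt_div (hg.trans_le (min_le_right _ _))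

lemma hasSpectralRepr_noise [IsProbabilityMeasure P] (hB : IsBrownianReal B P)
    (hU : ∀ t, U (spectralFun 0 t) =ᵐ[P] fun ω => ((√(2 * Real.pi) * X B 0 t ω : ℝ) : ℂ))
    (n : ℕ) : HasSpectralRepr P (noise U) (H n) (X B n) := fun t => by
  refine ⟨_, isNoiseIntegral_noise (memLp_mul_exp (memLp_H n) t), ?_⟩
  filter_upwards [spectral_isometry_spectralFun hB hU n t] with ω hω
  have h3 : (√(2 * Real.pi) : ℂ) * √(2 * Real.pi) = 2 * Real.pi := by
    rw [← ofReal_mul, Real.mul_self_sqrt (by positivity)]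
    push_cast
    rfl
  have h4 : (2 * Real.pi : ℂ) ≠ 0 := by
    have : (2 * Real.pi : ℝ) ≠ 0 := by positivity
    exact_mod_cast this
  rw [spectralFun] at hω
  rw [hω, ofReal_mul, ← mul_assoc (√(2 * Real.pi) : ℂ), h3, ← mul_assoc, one_div_mul_cancel h4,
    one_mul]

/-! ### Linearity of the stochastic integral -/

variable {ζ : FiniteBorel → Ω → ℂ}

lemma IsNoiseIntegral.zero : IsNoiseIntegral P ζ (fun _ => 0) fun _ => 0 := by
  refine ⟨MemLp.zero', MemLp.zero', fun ε hε => ⟨0, Fin.elim0, Fin.elim0, ?_, ?_⟩⟩ <;>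
  simpa using hε

lemma IsNoiseIntegral.add (hζ : ∀ A, AEStronglyMeasurable (ζ A) P) {F G : ℝ → ℂ} {J K : Ω → ℂ}
    (hF : IsNoiseIntegral P ζ F J) (hG : IsNoiseIntegral P ζ G K) :
    IsNoiseIntegral P ζ (fun v => F v + G v) fun ω => J ω + K ω := by
  obtain ⟨hF1, hF2, hF3⟩ := hF
  obtain ⟨hG1, hG2, hG3⟩ := hG
  refine ⟨hF1.add hG1, hF2.add hG2, fun ε hε => ?_⟩
  obtain ⟨m, c, A, h1, h2⟩ := hF3 (ε / 2) (ENNReal.half_pos hε.ne')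
  obtain ⟨m', c', A', h1', h2'⟩ := hG3 (ε / 2) (ENNReal.half_pos hε.ne')
  have hind : ∀ {m : ℕ} (c : Fin m → ℂ) (A : Fin m → FiniteBorel),
      AEStronglyMeasurable (fun v => ∑ i, (A i).1.indicator (fun _ => c i) v) volume :=
    fun c A => Finset.aestronglyMeasurable_fun_sum _ fun i _ =>
      aestronglyMeasurable_const.indicator (A i).2.1
  have hsumζ : ∀ {m : ℕ} (c : Fin m → ℂ) (A : Fin m → FiniteBorel),
      AEStronglyMeasurable (fun ω => ∑ i, c i * ζ (A i) ω) P :=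
    fun c A => Finset.aestronglyMeasurable_fun_sum _ fun i _ => (hζ (A i)).const_mul _
  refine ⟨m + m', Fin.append c c', Fin.append A A', ?_, ?_⟩
  · have : (fun v => F v + G v -
        ∑ i, (Fin.append A A' i).1.indicator (fun _ => Fin.append c c' i) v) =
        (fun v => F v - ∑ i, (A i).1.indicator (fun _ => c i) v) +
        fun v => G v - ∑ i, (A' i).1.indicator (fun _ => c' i) v := by
      funext v
      simp only [Fin.sum_univ_add, Fin.append_left, Fin.append_right, Pi.add_apply]
      ring
    rw [this]
    refine (eLpNorm_add_le (hF1.1.sub (hind c A)) (hG1.1.sub (hind c' A')) one_le_two).trans_lt ?_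
    exact (ENNReal.add_lt_add h1 h1').trans_eq (ENNReal.add_halves ε)
  · have : (fun ω => J ω + K ω - ∑ i, Fin.append c c' i * ζ (Fin.append A A' i) ω) =
        (fun ω => J ω - ∑ i, c i * ζ (A i) ω) + fun ω => K ω - ∑ i, c' i * ζ (A' i) ω := by
      funext ω
      simp only [Fin.sum_univ_add, Fin.append_left, Fin.append_right, Pi.add_apply]
      ring
    rw [this]
    refine (eLpNorm_add_le (hF2.1.sub (hsumζ c A)) (hG2.1.sub (hsumζ c' A')) one_le_two).trans_lt ?_
    exact (ENNReal.add_lt_add h2 h2').trans_eq (ENNReal.add_halves ε)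

lemma IsNoiseIntegral.const_mul (a : ℂ) {F : ℝ → ℂ} {J : Ω → ℂ}
    (hF : IsNoiseIntegral P ζ F J) :
    IsNoiseIntegral P ζ (fun v => a * F v) fun ω => a * J ω := by
  obtain ⟨hF1, hF2, hF3⟩ := hF
  refine ⟨hF1.const_mul a, hF2.const_mul a, fun ε hε => ?_⟩
  have htop : ‖a‖ₑ + 1 ≠ ∞ := ENNReal.add_ne_top.2 ⟨enorm_ne_top, ENNReal.one_ne_top⟩
  obtain ⟨m, c, A, h1, h2⟩ := hF3 (ε / (‖a‖ₑ + 1)) (ENNReal.div_pos hε.ne' htop)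
  have hlt : ∀ x : ℝ≥0∞, x < ε / (‖a‖ₑ + 1) → ‖a‖ₑ * x < ε := fun x hx => by
    refine lt_of_le_of_lt ?_ (ENNReal.mul_lt_of_lt_div hx)
    rw [mul_comm]
    gcongr
    exact le_self_add
  refine ⟨m, fun i => a * c i, A, ?_, ?_⟩
  · have : (fun v => a * F v - ∑ i, (A i).1.indicator (fun _ => a * c i) v) =
        a • fun v => F v - ∑ i, (A i).1.indicator (fun _ => c i) v := by
      funext v
      simp only [Pi.smul_apply, smul_eq_mul, mul_sub, Finset.mul_sum]
      congr 1
      refine Finset.sum_congr rfl fun i _ => ?_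
      by_cases hv : v ∈ (A i).1 <;> simp [hv]
    rw [this, eLpNorm_const_smul]
    exact hlt _ h1
  · have : (fun ω => a * J ω - ∑ i, a * c i * ζ (A i) ω) =
        a • fun ω => J ω - ∑ i, c i * ζ (A i) ω := by
      funext ω
      simp only [Pi.smul_apply, smul_eq_mul, mul_sub, Finset.mul_sum, mul_assoc]
    rw [this, eLpNorm_const_smul]
    exact hlt _ h2

lemma IsNoiseIntegral.sum (hζ : ∀ A, AEStronglyMeasurable (ζ A) P) {ι : Type*} (s : Finset ι)
    {F : ι → ℝ → ℂ} {J : ι → Ω → ℂ} (h : ∀ i ∈ s, IsNoiseIntegral P ζ (F i) (J i)) :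
    IsNoiseIntegral P ζ (fun v => ∑ i ∈ s, F i v) fun ω => ∑ i ∈ s, J i ω := by
  classical
  induction s using Finset.induction_on with
  | empty => simpa using IsNoiseIntegral.zero
  | insert i s hi ih =>
    simp only [Finset.sum_insert hi]
    exact (h i (Finset.mem_insert_self i s)).add hζ
      (ih fun j hj => h j (Finset.mem_insert_of_mem hj))

end Noise

end IntegratedBrownian

namespace IntegratedBrownian

/-! ### The innovations -/

section Innovation

variable {Ω : Type*} [MeasurableSpace Ω] {P : Measure Ω} [IsProbabilityMeasure P]
  {B : ℝ≥0 → Ω → ℝ}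

lemma integral_X (hB : IsBrownianReal B P) (n : ℕ) (t : ℝ) : ∫ ω, X B n t ω ∂P = 0 := by
  obtain ⟨U, hU⟩ := exists_spectral_isometry hB
  have h := integral_spectral_isometry hB hU (spectralFun n t)
  rw [integral_congr_ae (spectral_isometry_spectralFun hB hU n t), integral_complex_ofReal,
    ofReal_eq_zero, integral_const_mul] at h
  exact (mul_eq_zero.1 h).resolve_left (by positivity)

/-- The variables `X₀(t), …, Xₙ(t)` are jointly Gaussian. -/
lemma hasGaussianLaw_X (hB : IsBrownianReal B P) (n : ℕ) (t : ℝ) :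
    HasGaussianLaw (fun ω (k : Fin (n + 1)) => X B k t ω) P := by
  obtain ⟨U, hU⟩ := exists_spectral_isometry hB
  have h := (hasGaussianLaw_spectral_isometry hB hU (fun k : Fin (n + 1) => spectralFun k t)
    (fun k ω => ((√(2 * Real.pi) * X B k t ω : ℝ) : ℂ))
    fun k => (spectral_isometry_spectralFun hB hU k t).symm).map_fun
    (ContinuousLinearMap.pi fun k => (√(2 * Real.pi))⁻¹ •
      (reCLM ∘L ContinuousLinearMap.proj (R := ℝ) k))
  have h0 : √(2 * Real.pi) ≠ 0 := by positivity
  refine h.congr (Filter.Eventually.of_forall fun ω => funext fun k => ?_)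
  have hk : (√(2 * Real.pi))⁻¹ * (√(2 * Real.pi) * X B k t ω) = X B k t ω :=
    inv_mul_cancel_left₀ h0 _
  simpa using hk

lemma memLp_X (hB : IsBrownianReal B P) (n : ℕ) (t : ℝ) : MemLp (X B n t) 2 P :=
  ((hasGaussianLaw_X hB n t).eval (Fin.last n)).memLp_two

/-- If `Ĥₙ = Hₙ + ∑ aⱼ Hⱼ`, then `Xₙ(t) + ∑ aⱼ Xⱼ(t)` is uncorrelated with `X₀(t), …, Xₙ₋₁(t)`. -/
lemma integral_add_sum_mul_X (hB : IsBrownianReal B P) {n : ℕ} {a : ℕ → ℝ}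
    (ha : ∀ v, Hhat n v = H n v + ∑ j ∈ Finset.range n, (a j : ℂ) * H j v) (t : ℝ) {j : ℕ}
    (hj : j < n) :
    ∫ ω, (X B n t ω + ∑ i ∈ Finset.range n, a i * X B i t ω) * X B j t ω ∂P = 0 := by
  obtain ⟨U, hU⟩ := exists_spectral_isometry hB
  set F : Lp ℂ 2 (volume : Measure ℝ) :=
    spectralFun n t + ∑ i ∈ Finset.range n, (a i : ℂ) • spectralFun i t with hF
  have hFv : F =ᵐ[volume] fun v : ℝ => Hhat n v * cexp (I * v * t) := by
    have h1 : ∀ᵐ v : ℝ, ∀ i ∈ Finset.range n,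
        ((a i : ℂ) • spectralFun i t : Lp ℂ 2 (volume : Measure ℝ)) v =
        a i * (H i v * cexp (I * v * t)) := by
      rw [Filter.eventually_all_finset]
      intro i _
      filter_upwards [Lp.coeFn_smul (a i : ℂ) (spectralFun i t), coeFn_spectralFun i t]
        with v e1 e2
      rw [e1, Pi.smul_apply, e2, smul_eq_mul]
    filter_upwards [Lp.coeFn_add (spectralFun n t)
      (∑ i ∈ Finset.range n, (a i : ℂ) • spectralFun i t), coeFn_spectralFun n t,
      Lp.coeFn_finsetSum (Finset.range n) fun i =>
        ((a i : ℂ) • spectralFun i t : Lp ℂ 2 (volume : Measure ℝ)), h1] with v e1 e2 e3 e4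
    rw [e1, Pi.add_apply, e2, e3, Finset.sum_apply, Finset.sum_congr rfl e4, ha v, add_mul,
      Finset.sum_mul]
    congr 1
    exact Finset.sum_congr rfl fun i _ => by ring
  have hUF : U F =ᵐ[P] fun ω => ((√(2 * Real.pi) *
      (X B n t ω + ∑ i ∈ Finset.range n, a i * X B i t ω) : ℝ) : ℂ) := by
    have h1 : ∀ᵐ ω ∂P, ∀ i ∈ Finset.range n,
        ((a i : ℂ) • U (spectralFun i t) : Lp ℂ 2 P) ω =
        ((√(2 * Real.pi) * (a i * X B i t ω) : ℝ) : ℂ) := by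
      rw [Filter.eventually_all_finset]
      intro i _
      filter_upwards [Lp.coeFn_smul (a i : ℂ) (U (spectralFun i t)),
        spectral_isometry_spectralFun hB hU i t] with ω e1 e2
      rw [e1, Pi.smul_apply, e2, smul_eq_mul, ← ofReal_mul]
      congr 1
      ring
    simp only [hF, map_add, map_sum, map_smul]
    filter_upwards [Lp.coeFn_add (U (spectralFun n t))
      (∑ i ∈ Finset.range n, (a i : ℂ) • U (spectralFun i t)),
      spectral_isometry_spectralFun hB hU n t,
      Lp.coeFn_finsetSum (Finset.range n) fun i =>
        ((a i : ℂ) • U (spectralFun i t) : Lp ℂ 2 P), h1] with ω e1 e2 e3 e4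
    rw [e1, Pi.add_apply, e2, e3, Finset.sum_apply, Finset.sum_congr rfl e4, ← ofReal_sum,
      ← ofReal_add, mul_add, Finset.mul_sum]
  have horth : inner ℂ (U (spectralFun j t)) (U F) = 0 := by
    rw [U.inner_map_map, L2.inner_def, ← integral_Hhat_mul_conj_H hj]
    refine integral_congr_ae ?_
    filter_upwards [hFv, coeFn_spectralFun j t] with v e1 e2
    have he : cexp (I * v * t) * cexp (-(I * v * t)) = 1 := by
      rw [← Complex.exp_add, add_neg_cancel, Complex.exp_zero]
    rw [e1, e2, RCLike.inner_apply, map_mul, conj_exp_I_mul]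
    linear_combination (Hhat n v * conj (H j v)) * he
  have hprod : inner ℂ (U (spectralFun j t)) (U F) = ((2 * Real.pi *
      ∫ ω, (X B n t ω + ∑ i ∈ Finset.range n, a i * X B i t ω) * X B j t ω ∂P : ℝ) : ℂ) := by
    rw [L2.inner_def, ← integral_const_mul, ← integral_complex_ofReal]
    refine integral_congr_ae ?_
    filter_upwards [hUF, spectral_isometry_spectralFun hB hU j t] with ω e1 e2
    rw [e1, e2, RCLike.inner_apply, conj_ofReal, ← ofReal_mul]
    congr 1
    have := Real.mul_self_sqrt (show 0 ≤ 2 * Real.pi by positivity)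
    linear_combination ((X B n t ω + ∑ i ∈ Finset.range n, a i * X B i t ω) * X B j t ω) * this
  rw [horth] at hprod
  exact (mul_eq_zero.1 (ofReal_eq_zero.1 hprod.symm)).resolve_left (by positivity)

/-- The `Xⱼ(t)` being jointly Gaussian, an uncorrelated linear combination is independent of
`X₀(t), …, Xₙ₋₁(t)`, and so it is the innovation. -/
lemma innovation_ae_eq (hB : IsBrownianReal B P)
    (hX : ∀ (n : ℕ) (t : ℝ), Measurable (X B n t)) {n : ℕ} {a : ℕ → ℝ}
    (ha : ∀ v, Hhat n v = H n v + ∑ j ∈ Finset.range n, (a j : ℂ) * H j v) (t : ℝ) :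
    innovation P B n t =ᵐ[P] fun ω => X B n t ω + ∑ j ∈ Finset.range n, a j * X B j t ω := by
  set S : Ω → ℝ := fun ω => ∑ j ∈ Finset.range n, a j * X B j t ω with hS
  set Z : Ω → ℝ := fun ω => X B n t ω + S ω with hZ
  have hXi : ∀ k, Integrable (X B k t) P := fun k => (memLp_X hB k t).integrable one_le_two
  have hSi : Integrable S P := integrable_finsetSum _ fun j _ => (hXi j).const_mul _
  have hZi : Integrable Z P := (hXi n).add hSi
  have hSm : Measurable S := Finset.measurable_fun_sum _ fun j _ => (hX j t).const_mul _
  have hZm : Measurable Z := (hX n t).add hSm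
  have hZ0 : ∫ ω, Z ω ∂P = 0 := by
    rw [hZ, integral_add (hXi n) hSi, integral_X hB, zero_add, hS,
      integral_finsetSum _ fun j _ => (hXi j).const_mul _]
    simp [integral_const_mul, integral_X hB]
  have hgauss : HasGaussianLaw
      (fun ω => ((fun _ : Unit => Z ω), fun j : Fin n => X B j t ω)) P := by
    set L : (Fin (n + 1) → ℝ) →L[ℝ] (Unit → ℝ) × (Fin n → ℝ) :=
      (ContinuousLinearMap.pi fun _ : Unit => ContinuousLinearMap.proj (R := ℝ) (Fin.last n) +
        ∑ j : Fin n, a j • ContinuousLinearMap.proj (R := ℝ) j.castSucc).prod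
        (ContinuousLinearMap.pi fun j : Fin n => ContinuousLinearMap.proj (R := ℝ) j.castSucc)
      with hL
    refine ((hasGaussianLaw_X hB n t).map_fun L).congr
      (Filter.Eventually.of_forall fun ω => Prod.ext (funext fun _ => ?_) (funext fun j => ?_))
    · simp [hL, hZ, hS, Finset.sum_range]
    · simp [hL]
  have hZ2 : MemLp Z 2 P := (hgauss.fst.eval ()).memLp_two
  have hindep : IndepFun (fun ω (_ : Unit) => Z ω) (fun ω (j : Fin n) => X B j t ω) P := by
    refine hgauss.indepFun_of_covariance_eval (X := fun _ => Z) (Y := fun j : Fin n => X B j t)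
      fun _ j => ?_
    rw [covariance_eq_sub hZ2 (memLp_X hB j t), integral_X hB, mul_zero, sub_zero]
    exact integral_add_sum_mul_X hB ha t j.2
  have hle : lowerSigma B n t ≤ ‹MeasurableSpace Ω› := iSup_le fun k => (hX k t).comap_le
  have hcomap : lowerSigma B n t =
      MeasurableSpace.comap (fun ω (j : Fin n) => X B j t ω) inferInstance := by
    change _ = MeasurableSpace.comap _ MeasurableSpace.pi
    simp only [MeasurableSpace.pi, MeasurableSpace.comap_iSup, MeasurableSpace.comap_comp]
    rfl
  have hindep' : Indep (MeasurableSpace.comap Z inferInstance) (lowerSigma B n t) P := by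
    rw [hcomap]
    exact (IndepFun_iff_Indep _ _ _).1
      (hindep.comp (φ := fun u : Unit → ℝ => u ()) (measurable_pi_apply ()) measurable_id)
  have hcZ : P[Z | lowerSigma B n t] =ᵐ[P] fun _ => ∫ ω, Z ω ∂P :=
    condExp_indep_eq hZm.comap_le hle (comap_measurable Z).stronglyMeasurable hindep'
  have hcS : P[S | lowerSigma B n t] = S := by
    refine condExp_of_stronglyMeasurable hle (Measurable.stronglyMeasurable ?_) hSi
    refine Finset.measurable_fun_sum _ fun j hj => Measurable.const_mul ?_ _
    have h1 : Measurable[MeasurableSpace.comap (X B j t) inferInstance] (X B j t) :=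
      comap_measurable _
    exact h1.mono (le_iSup (fun k : Fin n => MeasurableSpace.comap (X B k t) inferInstance)
      ⟨j, Finset.mem_range.1 hj⟩) le_rfl
  have hXZ : X B n t = Z - S := by
    funext ω
    simp [hZ]
  have hc := condExp_sub hZi hSi (lowerSigma B n t)
  rw [← hXZ] at hc
  filter_upwards [hc, hcZ] with ω e1 e2
  rw [innovation, e1, Pi.sub_apply, e2, hZ0, hcS]
  simp [hZ]

lemma hasSpectralRepr_innovation (hB : IsBrownianReal B P)
    (hX : ∀ (n : ℕ) (t : ℝ), Measurable (X B n t)) {ζ : FiniteBorel → Ω → ℂ}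
    (hζ : IsSpectralNoise P ζ) (h : ∀ n, HasSpectralRepr P ζ (H n) (X B n)) (n : ℕ) :
    HasSpectralRepr P ζ (Hhat n) (innovation P B n) := fun t => by
  obtain ⟨a, ha⟩ := exists_Hhat_eq_H_add_sum n
  have hm : ∀ A, AEStronglyMeasurable (ζ A) P := fun A =>
    (hζ.gaussian.aemeasurable A).aestronglyMeasurable
  choose J hJ hJX using fun k => h k t
  refine ⟨fun ω => J n ω + ∑ j ∈ Finset.range n, a j * J j ω, ?_, ?_⟩
  · have hlin := (hJ n).add hm
      (IsNoiseIntegral.sum hm (Finset.range n) fun j _ => (hJ j).const_mul (a j : ℂ))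
    convert! hlin using 2 with v
    rw [ha, add_mul, Finset.sum_mul]
    congr 1
    exact Finset.sum_congr rfl fun j _ => by ring
  · filter_upwards [innovation_ae_eq hB hX ha t, ae_all_iff.2 hJX] with ω e1 e2
    rw [e1, mul_add, Finset.mul_sum]
    push_cast
    rw [e2 n]
    congr 1
    refine Finset.sum_congr rfl fun j _ => ?_
    rw [e2 j]
    ring

end Innovation

end IntegratedBrownian

/-- `B` is a standard Brownian motion. The hypothesis `hX` only says that the `Xₙ(t)` are random
variables; it holds as soon as all `B t` are measurable and all paths are continuous, and it is
there because Mathlib's Brownian motions have merely a.e.-measurable values and almost surely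
continuous paths. -/
theorem proposition4p1 {Ω : Type*} [MeasurableSpace Ω] (P : Measure Ω) [IsProbabilityMeasure P]
    (B : ℝ≥0 → Ω → ℝ) (hB : IsBrownianReal B P)
    (hX : ∀ (n : ℕ) (t : ℝ), Measurable (IntegratedBrownian.X B n t)) :
    -- there is a spectral noise `ζ` that drives all the processes `Xₙ` with transfer functions `Hₙ`
    (∃ ζ : IntegratedBrownian.FiniteBorel → Ω → ℂ, IntegratedBrownian.IsSpectralNoise P ζ ∧
      ∀ n : ℕ, IntegratedBrownian.HasSpectralRepr P ζ (IntegratedBrownian.H n)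
        (IntegratedBrownian.X B n)) ∧
    -- for every such `ζ`, the innovations are driven by `ζ` with transfer functions `Ĥₙ`
    (∀ ζ : IntegratedBrownian.FiniteBorel → Ω → ℂ, IntegratedBrownian.IsSpectralNoise P ζ →
      (∀ n : ℕ, IntegratedBrownian.HasSpectralRepr P ζ (IntegratedBrownian.H n)
        (IntegratedBrownian.X B n)) →
      ∀ n : ℕ, IntegratedBrownian.HasSpectralRepr P ζ (IntegratedBrownian.Hhat n)
        (IntegratedBrownian.innovation P B n)) ∧
    -- the first form of the transfer function of the innovation
    (∀ (n : ℕ) (v : ℝ), 1 ≤ n → IntegratedBrownian.Hhat n v =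
      ((n.factorial : ℂ) / ((2 * n).factorial : ℂ)) *
        (IntegratedBrownian.H n v / conj (IntegratedBrownian.H (n - 1) v))) := by
  refine ⟨?_, fun ζ hζ h n => IntegratedBrownian.hasSpectralRepr_innovation hB hX hζ h n,
    fun n v hn => IntegratedBrownian.Hhat_eq_H_div_conj_H n v hn⟩
  obtain ⟨U, hU⟩ := IntegratedBrownian.exists_spectral_isometry hB
  exact ⟨IntegratedBrownian.noise U, IntegratedBrownian.isSpectralNoise_noise hB hU,
    IntegratedBrownian.hasSpectralRepr_noise hB hU⟩
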